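/- Let $G$ be a connected compact metric graph, i.e. a connected finite graph with vertex set $V$ and edge set $E$, without loops and without multiple edges, in which every edge $e$ has a finite length $\ell_e>0$ and is identified with $[0,\ell_e]$, the points $0$ and $\ell_e$ being its initial and terminal vertices. A function $u$ on $G$ is a family $([u]_e)_{e\in E}$ of functions on $(0,\ell_e)$, and $\int_G u=\sum_e\int_0^{\ell_e}[u]_e$. For each $e\in E$ let $1<p_e<\infty$ and let $\gamma_e:\mathbb R\to\mathbb R$ be continuous and (strictly) increasing with $\gamma_e(\mathbb R)=\mathbb R$ and $\gamma_e(0)=0$; write $v=\overline\gamma(u)$ if $[v]_e=\gamma_e([u]_e)$ a.e. for all $e$. For a family $\overline q=(q_e)$ of exponents $q_e\ge 1$ let $\mathcal W^{1,\overline q}(G)$ be the space of functions $u$ on $G$ with $[u]_e\in W^{1,q_e}(0,\ell_e)$ for all $e$ that are continuous on the graph (the values at a vertex $a$ of the continuous representatives of $[u]_e$, for all edges $e$ at $a$, coincide; the common value is $u(a)$), with the norm $\sum_e(\|[u]_e\|_{L^{q_e}}^{q_e}+\|[u]_e'\|_{L^{q_e}}^{q_e})^{1/q_e}$; put $\mathcal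 W^{1,1}(G)=\mathcal W^{1,\overline q}(G)$ for $q_e\equiv1$. Let $L^{\overline p}(0,T;\mathcal W^{1,\overline p}(G))$ be the space of those $h\in L^1(0,T;\mathcal W^{1,\overline p}(G))$ with $[h]_e\in L^{p_e}(0,T;W^{1,p_e}(0,\ell_e))$ for all $e$. Let $v_0\in L^1(G)$, $f\in L^1_{loc}([0,\infty);L^1(G))$ and $\omega\in L^1_{loc}([0,\infty);L^1(V))$, where $L^1(V)=\mathbb R^V$ with the $1$-norm. A *weak solution* of the evolution problem $\partial_t v-\Delta_{\overline p}u=f$, $v=\overline\gamma(u)$, $u$ continuous, with flux $\omega_a(t)$ at each vertex $a$ and $v(0)=v_0$, is a function $v:[0,\infty)\to L^1(G)$ with $v(0)=v_0$ such that for every $T>0$ one has $v\in C([0,T];L^1(G))$ and there is $u\in L^{\overline p}(0,T;\mathcal W^{1,\overline p}(G))$ with $v(t)=\overline\gamma(u(t))$ for a.e. $t\in(0,T)$ and $$-\int_0^T\!\!\int_G v(t)\,\partial_t\psi(t)\,dx\,dt+\sum_{e\in E}\int_0^T\!\!\int_0^{\ell_e}|[u(t)]_e'|^{p_e-2}[u(t)]_e'[\psi(t)]_e'\,dx\,dt=\int_0^T\!\!\int_G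 f(t)\psi(t)\,dx\,dt+\sum_{a\in V}\int_0^T\omega_a(t)\psi(t)(a)\,dt$$ for all $\psi\in W^{1,1}(0,T;\mathcal W^{1,1}(G))\cap L^{\overline p}(0,T;\mathcal W^{1,\overline p}(G))$ with $\psi(0)=\psi(T)=0$. Let $X=L^1(G)\times L^1(V)$ with the norm $\|(v,w)\|=\int_G|v|+\sum_{a\in V}|w_a|$, and let $\mathcal A\subset X\times X$ be the operator consisting of all pairs $((z,0),(\tilde v,\tilde\omega))$ such that $z$ is a weak solution of the elliptic problem with data $z+\tilde v$ and $\tilde\omega$, i.e. there is $\tilde u\in\mathcal W^{1,\overline p}(G)$ with $z=\overline\gamma(\tilde u)$ a.e. and $$\int_G z\varphi\,dx+\sum_{e\in E}\int_0^{\ell_e}|[\tilde u]_e'|^{p_e-2}[\tilde u]_e'[\varphi]_e'\,dx=\int_G(z+\tilde v)\varphi\,dx+\sum_{a\in V}\tilde\omega_a\varphi(a)\qquad\text{for all }\varphi\in\mathcal W^{1,\overline p}(G).$$ **Theorem.** If $v$ is a weak solution of the evolution problem, then for every $T>0$ the function $W=(v,0)$ is an integral solution (in the sense of Bénilan) on $[0,T]$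 of the abstract Cauchy problem $W'+\mathcal A W\ni(f,\omega)$, $W(0)=(v_0,0)$, in $X$. That is: $W\in C([0,T];X)$, $W(0)=(v_0,0)$, and for all $(x,y)\in\mathcal A$ the inequality $$\frac{d}{dt}\|W(t)-x\|\le[\,W(t)-x,\,(f(t),\omega(t))-y\,]$$ holds in $\mathcal D'(]0,T[)$ (tested with nonnegative functions of $\mathcal D(]0,T[)$), its right-hand side being locally integrable in $]0,T[$, where $[x,y]=\lim_{\lambda\downarrow0}(\|x+\lambda y\|-\|x\|)/\lambda$. -/

import Mathlib

open MeasureTheory Set Filter Topology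
open scoped ENNReal


noncomputable section

/-! ### Scalar test functions and vector-valued weak derivatives -/

/-- `φ ∈ 𝒟(]a, b[)`. -/
structure IsScalarTest (a b : ℝ) (φ : ℝ → ℝ) : Prop where
  smooth : ContDiff ℝ ((⊤ : ℕ∞) : WithTop ℕ∞) φ
  compact : HasCompactSupport φ
  support : tsupport φ ⊆ Ioo a b

/-- `g` is the weak derivative of `u` on `]a, b[`. This is only used for functions that are
integrable on `]a, b[`, with values in a Banach space. -/
def HasWeakDeriv {F : Type*} [NormedAddCommGroup F] [NormedSpace ℝ F] [CompleteSpace F]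
    (a b : ℝ) (u g : ℝ → F) : Prop :=
  ∀ φ : ℝ → ℝ, IsScalarTest a b φ →
    ∫ x in Ioo a b, deriv φ x • u x = - ∫ x in Ioo a b, φ x • g x

/-! ### Integral solutions of abstract Cauchy problems -/

section Abstract

variable {X : Type*} [NormedAddCommGroup X] [NormedSpace ℝ X]

/-- The bracket `[x, y] = lim_{λ ↓ 0} (‖x + λ y‖ - ‖x‖) / λ`. -/
def normBracket (x y : X) : ℝ :=
  limUnder (𝓝[>] (0 : ℝ)) fun r : ℝ => (‖x + r • y‖ - ‖x‖) / r

/-- The limit that defines the bracket always exists. -/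
theorem tendsto_normBracket (x y : X) :
    Tendsto (fun r : ℝ => (‖x + r • y‖ - ‖x‖) / r) (𝓝[>] (0 : ℝ)) (𝓝 (normBracket x y)) := by
  have hc : ConvexOn ℝ univ fun r : ℝ => ‖x + r • y‖ := by
    refine ⟨convex_univ, fun r _ s _ a b ha hb hab => ?_⟩
    have h : x + (a • r + b • s) • y = a • (x + r • y) + b • (x + s • y) := by
      calc x + (a • r + b • s) • y = (a + b) • x + (a • r + b • s) • y := by rw [hab, one_smul]
        _ = a • (x + r • y) + b • (x + s • y) := by
          simp only [smul_eq_mul, add_smul, smul_add, mul_smul]; abel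
    calc ‖x + (a • r + b • s) • y‖ ≤ ‖a • (x + r • y)‖ + ‖b • (x + s • y)‖ := by
          rw [h]; exact norm_add_le _ _
      _ = a • ‖x + r • y‖ + b • ‖x + s • y‖ := by
          rw [norm_smul, norm_smul, Real.norm_of_nonneg ha, Real.norm_of_nonneg hb]; rfl
  have hd := hc.hasDerivWithinAt_rightDeriv_of_mem_interior (x := 0) (by simp)
  rw [hasDerivWithinAt_iff_tendsto_slope' (by simp)] at hd
  refine tendsto_nhds_limUnder ⟨_, hd.congr fun r => ?_⟩
  simp [slope_def_field]

/-- `w` is an integral solution on `[0, T]` of `w' + A w ∋ F`, `w(0) = w₀`, for the (multivalued)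
operator with graph `A`: the inequality `d/dt ‖w(t) - x‖ ≤ [w(t) - x, F(t) - y]` holds in
`𝒟'(]0, T[)` for all `(x, y) ∈ A`, its right-hand side being locally integrable in `]0, T[`. -/
structure IsIntegralSolution (A : Set (X × X)) (F : ℝ → X) (w₀ : X) (T : ℝ) (w : ℝ → X) :
    Prop where
  continuousOn : ContinuousOn w (Icc 0 T)
  initial : w 0 = w₀
  locallyIntegrable : ∀ x y : X, (x, y) ∈ A →
    LocallyIntegrableOn (fun t => normBracket (w t - x) (F t - y)) (Ioo 0 T)
  inequality : ∀ x y : X, (x, y) ∈ A → ∀ ξ : ℝ → ℝ, IsScalarTest 0 T ξ → (∀ t, 0 ≤ ξ t) →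
    - ∫ t in Ioo 0 T, ‖w t - x‖ * deriv ξ t
      ≤ ∫ t in Ioo 0 T, normBracket (w t - x) (F t - y) * ξ t

end Abstract

/-! ### Compact metric graphs -/

/-- A compact metric graph with (finite) vertex set `V` and edge set `E`, without loops and without
multiple edges: every edge `e` has a finite length and is identified with `[0, length e]`,
the point `0` being its initial and the point `length e` its terminal vertex. -/
structure CompactMetricGraph (V E : Type*) [Fintype V] [Fintype E] where
  init : E → V
  term : E → V
  length : E → ℝ
  length_pos : ∀ e, 0 < length e
  no_loop : ∀ e, init e ≠ term e
  no_multiple : ∀ e e', s(init e, term e) = s(init e', term e') → e = e'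

namespace CompactMetricGraph

variable {V E : Type*} [Fintype V] [Fintype E] (G : CompactMetricGraph V E)

/-- Any two vertices are joined by a path. -/
def Connected : Prop :=
  (SimpleGraph.fromRel fun a b : V => ∃ e, G.init e = a ∧ G.term e = b).Connected

/-- Lebesgue measure on the edge `e`, that is, on `]0, ℓ_e[`. -/
abbrev edgeMeasure (e : E) : Measure ℝ := volume.restrict (Ioo 0 (G.length e))

/-- `L¹(G)`, with the norm `∑ₑ ‖[u]ₑ‖_{L¹(0, ℓₑ)}`. -/
abbrev L1 : Type _ := PiLp 1 fun e : E => Lp ℝ 1 (G.edgeMeasure e)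

/-- `L¹(V(G))`: the functions `V → ℝ`, with the `1`-norm. -/
abbrev VertexL1 (_G : CompactMetricGraph V E) : Type _ := PiLp 1 fun _ : V => ℝ

/-- `X = L¹(G) × L¹(V(G))`, with the sum of the two norms. -/
abbrev StateSpace : Type _ := WithLp 1 (G.L1 × G.VertexL1)

section Sobolev

variable (q : E → ℝ≥0∞) [∀ e, Fact (1 ≤ q e)]

/-- Pairs `(u, g)` of functions on the graph with `[u]ₑ, [g]ₑ ∈ L^{qₑ}(0, ℓₑ)`, with the norm
`∑ₑ (‖[u]ₑ‖^{qₑ} + ‖[g]ₑ‖^{qₑ})^{1/qₑ}`. -/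
abbrev PairSpace : Type _ :=
  PiLp 1 fun e : E => WithLp (q e) (Lp ℝ (q e) (G.edgeMeasure e) × Lp ℝ (q e) (G.edgeMeasure e))

variable {G q}

/-- The first function of a pair, on the edge `e`. -/
def PairSpace.fn (u : G.PairSpace q) (e : E) : ℝ → ℝ := (u e).fst

/-- The second function of a pair, on the edge `e`. -/
def PairSpace.der (u : G.PairSpace q) (e : E) : ℝ → ℝ := (u e).snd

/-- Every `[u]ₑ` has a representative that is continuous on `[0, ℓₑ]`, with the value `c v` at each
end of `e`, where `v` is the vertex at that end. So `u ∈ C(V(G))`, and `u(v) = c v`. -/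
def HasVertexValues (u : G.PairSpace q) (c : V → ℝ) : Prop :=
  ∀ e, ∃ r : ℝ → ℝ, ContinuousOn r (Icc 0 (G.length e)) ∧ u.fn e =ᵐ[G.edgeMeasure e] r ∧
    r 0 = c (G.init e) ∧ r (G.length e) = c (G.term e)

theorem PairSpace.integrable_fn (u : G.PairSpace q) (e : E) :
    Integrable (u.fn e) (G.edgeMeasure e) :=
  (Lp.memLp (u e).fst).integrable Fact.out

theorem PairSpace.integrable_der (u : G.PairSpace q) (e : E) :
    Integrable (u.der e) (G.edgeMeasure e) :=
  (Lp.memLp (u e).snd).integrable Fact.out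

theorem PairSpace.fn_add (u w : G.PairSpace q) (e : E) :
    (u + w).fn e =ᵐ[G.edgeMeasure e] fun x => u.fn e x + w.fn e x :=
  Lp.coeFn_add (u e).fst (w e).fst

theorem PairSpace.der_add (u w : G.PairSpace q) (e : E) :
    (u + w).der e =ᵐ[G.edgeMeasure e] fun x => u.der e x + w.der e x :=
  Lp.coeFn_add (u e).snd (w e).snd

theorem PairSpace.fn_smul (a : ℝ) (u : G.PairSpace q) (e : E) :
    (a • u).fn e =ᵐ[G.edgeMeasure e] fun x => a * u.fn e x :=
  Lp.coeFn_smul a (u e).fst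

theorem PairSpace.der_smul (a : ℝ) (u : G.PairSpace q) (e : E) :
    (a • u).der e =ᵐ[G.edgeMeasure e] fun x => a * u.der e x :=
  Lp.coeFn_smul a (u e).snd

theorem PairSpace.fn_zero (e : E) :
    (0 : G.PairSpace q).fn e =ᵐ[G.edgeMeasure e] fun _ => 0 :=
  Lp.coeFn_zero ℝ (q e) (G.edgeMeasure e)

theorem PairSpace.der_zero (e : E) :
    (0 : G.PairSpace q).der e =ᵐ[G.edgeMeasure e] fun _ => 0 :=
  Lp.coeFn_zero ℝ (q e) (G.edgeMeasure e)

end Sobolev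

theorem _root_.IsScalarTest.integrable_mul {a b : ℝ} {φ : ℝ → ℝ} (h : IsScalarTest a b φ)
    {μ : Measure ℝ} {u : ℝ → ℝ} (hu : Integrable u μ) :
    Integrable (fun x => φ x * u x) μ ∧ Integrable (fun x => deriv φ x * u x) μ := by
  obtain ⟨C, hC⟩ := h.compact.exists_bound_of_continuous h.smooth.continuous
  have hd : Continuous (deriv φ) := h.smooth.continuous_deriv (by simp)
  obtain ⟨D, hD⟩ := h.compact.deriv.exists_bound_of_continuous hd
  exact ⟨hu.bdd_mul h.smooth.continuous.aestronglyMeasurable (ae_of_all _ hC),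
    hu.bdd_mul hd.aestronglyMeasurable (ae_of_all _ hD)⟩

variable (q : E → ℝ≥0∞) [∀ e, Fact (1 ≤ q e)]

/-- The space `𝒲̃^{1,q}(G)` of the functions `u` on the graph with `[u]ₑ ∈ W^{1,qₑ}(0, ℓₑ)` for every
edge `e`; such a function is stored together with its weak derivative, so that the norm is the
Sobolev norm `∑ₑ (‖[u]ₑ‖^{qₑ} + ‖[u]ₑ'‖^{qₑ})^{1/qₑ}`. -/
def BrokenSobolev : Submodule ℝ (G.PairSpace q) where
  carrier := {u | ∀ e, HasWeakDeriv 0 (G.length e) (u.fn e) (u.der e)}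
  zero_mem' := by
    intro e φ hφ
    have h1 : ∫ x in Ioo 0 (G.length e), deriv φ x • (0 : G.PairSpace q).fn e x = 0 :=
      integral_eq_zero_of_ae (by
        filter_upwards [PairSpace.fn_zero (G := G) (q := q) e] with x hx; simp [hx])
    have h2 : ∫ x in Ioo 0 (G.length e), φ x • (0 : G.PairSpace q).der e x = 0 :=
      integral_eq_zero_of_ae (by
        filter_upwards [PairSpace.der_zero (G := G) (q := q) e] with x hx; simp [hx])
    rw [h1, h2, neg_zero]
  add_mem' := by
    intro u w hu hw e φ hφ
    have h1 := hu e φ hφ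
    have h2 := hw e φ hφ
    simp only [smul_eq_mul] at h1 h2 ⊢
    have h3 : ∫ x in Ioo 0 (G.length e), deriv φ x * (u + w).fn e x
        = ∫ x in Ioo 0 (G.length e), (deriv φ x * u.fn e x + deriv φ x * w.fn e x) :=
      integral_congr_ae (by filter_upwards [u.fn_add w e] with x hx; rw [hx, mul_add])
    have h4 : ∫ x in Ioo 0 (G.length e), φ x * (u + w).der e x
        = ∫ x in Ioo 0 (G.length e), (φ x * u.der e x + φ x * w.der e x) :=
      integral_congr_ae (by filter_upwards [u.der_add w e] with x hx; rw [hx, mul_add])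
    rw [h3, h4, integral_add (hφ.integrable_mul (u.integrable_fn e)).2
      (hφ.integrable_mul (w.integrable_fn e)).2,
      integral_add (hφ.integrable_mul (u.integrable_der e)).1
      (hφ.integrable_mul (w.integrable_der e)).1, h1, h2, neg_add]
  smul_mem' := by
    intro a u hu e φ hφ
    have h1 := hu e φ hφ
    simp only [smul_eq_mul] at h1 ⊢
    have h3 : ∫ x in Ioo 0 (G.length e), deriv φ x * (a • u).fn e x
        = ∫ x in Ioo 0 (G.length e), a * (deriv φ x * u.fn e x) :=
      integral_congr_ae (by filter_upwards [u.fn_smul a e] with x hx; rw [hx]; ring)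
    have h4 : ∫ x in Ioo 0 (G.length e), φ x * (a • u).der e x
        = ∫ x in Ioo 0 (G.length e), a * (φ x * u.der e x) :=
      integral_congr_ae (by filter_upwards [u.der_smul a e] with x hx; rw [hx]; ring)
    rw [h3, h4, integral_const_mul, integral_const_mul, h1, mul_neg]

/-- The space `𝒲^{1,q}(G) = 𝒲̃^{1,q}(G) ∩ C(V(G))`, with the Sobolev norm. -/
def Sobolev : Submodule ℝ (G.PairSpace q) where
  carrier := {u | u ∈ G.BrokenSobolev q ∧ ∃ c : V → ℝ, HasVertexValues u c}
  zero_mem' := ⟨zero_mem _, 0, fun e =>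
    ⟨fun _ => 0, continuousOn_const, PairSpace.fn_zero e, rfl, rfl⟩⟩
  add_mem' := by
    rintro u w ⟨hu, c, hc⟩ ⟨hw, d, hd⟩
    refine ⟨add_mem hu hw, c + d, fun e => ?_⟩
    obtain ⟨r, hr, hr1, hr2, hr3⟩ := hc e
    obtain ⟨s, hs, hs1, hs2, hs3⟩ := hd e
    refine ⟨fun x => r x + s x, hr.add hs, ?_, by simp [hr2, hs2], by simp [hr3, hs3]⟩
    filter_upwards [u.fn_add w e, hr1, hs1] with x h1 h2 h3
    rw [h1, h2, h3]
  smul_mem' := by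
    rintro a u ⟨hu, c, hc⟩
    refine ⟨Submodule.smul_mem _ a hu, a • c, fun e => ?_⟩
    obtain ⟨r, hr, hr1, hr2, hr3⟩ := hc e
    refine ⟨fun x => a * r x, continuousOn_const.mul hr, ?_, by simp [hr2], by simp [hr3]⟩
    filter_upwards [u.fn_smul a e, hr1] with x h1 h2
    rw [h1, h2]

variable {G q}

/-- `[u]ₑ`. -/
def Sobolev.fn (u : G.Sobolev q) (e : E) : ℝ → ℝ := (u : G.PairSpace q).fn e

/-- `[u]ₑ'`. -/
def Sobolev.der (u : G.Sobolev q) (e : E) : ℝ → ℝ := (u : G.PairSpace q).der e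

/-- The value `u(v)` of `u ∈ 𝒲^{1,q}(G)` at the vertex `v`. -/
def Sobolev.vertexValue (u : G.Sobolev q) : V → ℝ := u.2.2.choose

theorem Sobolev.hasVertexValues (u : G.Sobolev q) :
    HasVertexValues (u : G.PairSpace q) (Sobolev.vertexValue u) := u.2.2.choose_spec

/-- The vertex values are determined by `u`. -/
theorem Sobolev.vertexValue_unique (u : G.Sobolev q) {c : V → ℝ}
    (hc : HasVertexValues (u : G.PairSpace q) c) (e : E) :
    Sobolev.vertexValue u (G.init e) = c (G.init e) ∧
      Sobolev.vertexValue u (G.term e) = c (G.term e) := by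
  obtain ⟨r, hr, hr1, hr2, hr3⟩ := hc e
  obtain ⟨s, hs, hs1, hs2, hs3⟩ := Sobolev.hasVertexValues u e
  have hl := G.length_pos e
  have h : EqOn s r (Icc 0 (G.length e)) :=
    Measure.eqOn_Icc_of_ae_eq (μ := volume) hl.ne (by
      rw [← restrict_Ioo_eq_restrict_Icc]
      exact hs1.symm.trans hr1) hs hr
  exact ⟨by rw [← hs2, ← hr2]; exact h (left_mem_Icc.2 hl.le),
    by rw [← hs3, ← hr3]; exact h (right_mem_Icc.2 hl.le)⟩

variable (G) (p : E → ℝ≥0∞) [∀ e, Fact (1 ≤ p e)]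

/-! ### The elliptic problem and the operator `𝒜` -/

/-- `∑ₑ ∫₀^{ℓₑ} |[u]ₑ'|^{pₑ-2} [u]ₑ' [φ]ₑ' dx`. -/
def pLaplaceForm (u φ : G.Sobolev p) : ℝ :=
  ∑ e, ∫ x in Ioo 0 (G.length e),
    |Sobolev.der u e x| ^ ((p e).toReal - 2) * Sobolev.der u e x * Sobolev.der φ e x

variable {p} in
/-- `∫_G v φ dx`, for `v ∈ L¹(G)` and `φ ∈ 𝒲^{1,p}(G)`. -/
def pairing (v : G.L1) (φ : G.Sobolev p) : ℝ :=
  ∑ e, ∫ x in Ioo 0 (G.length e), v e x * Sobolev.fn φ e x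

/-- `v` is a weak solution of the elliptic problem `v - Δ_p u = f`, `v = γ(u)`, with `u` continuous
and with the flux `ω_v` at each vertex `v`. -/
def IsEllipticWeakSolution (γ : E → ℝ → ℝ) (f : G.L1) (ω : G.VertexL1) (v : G.L1) : Prop :=
  ∃ u : G.Sobolev p, (∀ e, v e =ᵐ[G.edgeMeasure e] fun x => γ e (Sobolev.fn u e x)) ∧
    ∀ φ : G.Sobolev p, G.pairing v φ + G.pLaplaceForm p u φ
      = G.pairing f φ + ∑ a, ω a * Sobolev.vertexValue φ a

/-- The operator `𝒜` in `X`, as a graph: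
`((v, 0), (ṽ, ω)) ∈ 𝒜` iff `v` is a weak solution of the elliptic problem with the data
`f = v + ṽ` and `ω`. -/
def graphOperator (γ : E → ℝ → ℝ) : Set (G.StateSpace × G.StateSpace) :=
  {P | P.1.snd = 0 ∧
    G.IsEllipticWeakSolution p γ (P.1.fst + P.2.fst) P.2.snd P.1.fst}

/-! ### The evolution problem -/

variable {p} in
/-- `u ∈ L^p(0, T; 𝒲^{1,p}(G))`: `u ∈ L¹(0, T; 𝒲^{1,p}(G))` and
`[u]ₑ ∈ L^{pₑ}(0, T; W^{1,pₑ}(0, ℓₑ))` for every edge `e`. -/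
def MemLpTime (T : ℝ) (u : ℝ → G.Sobolev p) : Prop :=
  IntegrableOn u (Ioo 0 T) ∧
    ∀ e, MemLp (fun t => (u t : G.PairSpace p) e) (p e) (volume.restrict (Ioo 0 T))

/-- `𝒲^{1,1}(G)`. -/
abbrev SobolevOne : Submodule ℝ (G.PairSpace fun _ => 1) := G.Sobolev fun _ => 1

variable {p} in
/-- `ψ ∈ W^{1,1}(0, T; 𝒲^{1,1}(G)) ∩ L^p(0, T; 𝒲^{1,p}(G))` with `ψ(0) = ψ(T) = 0`. Here `ψ` is
the continuous representative, `ψ'` is its time derivative (in the sense of distributions with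
values in the Banach space of pairs that contains `𝒲^{1,1}(G)`), and `ψp` is the same function as
`ψ`, read as a function with values in `𝒲^{1,p}(G)`. -/
structure IsEvolutionTest (T : ℝ) (ψ ψ' : ℝ → G.SobolevOne) (ψp : ℝ → G.Sobolev p) : Prop where
  continuousOn : ContinuousOn ψ (Icc 0 T)
  integrable_deriv : IntegrableOn ψ' (Ioo 0 T)
  hasWeakDeriv : HasWeakDeriv 0 T (fun t => (ψ t : G.PairSpace fun _ => 1))
    (fun t => (ψ' t : G.PairSpace fun _ => 1))
  memLp : G.MemLpTime T ψp
  same : ∀ᵐ t ∂(volume.restrict (Ioo 0 T)), ∀ e,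
    Sobolev.fn (ψp t) e =ᵐ[G.edgeMeasure e] Sobolev.fn (ψ t) e
  zero_left : ψ 0 = 0
  zero_right : ψ T = 0

/-- `v : [0, ∞) → L¹(G)` is a weak solution of the evolution problem
`∂ₜ v - Δ_p u = f`, `v = γ(u)`, `u` continuous, with the flux `ω` at the vertices and with
`v(0) = v₀`. -/
structure IsEvolutionWeakSolution (γ : E → ℝ → ℝ) (f : ℝ → G.L1) (ω : ℝ → G.VertexL1)
    (v₀ : G.L1) (v : ℝ → G.L1) : Prop where
  initial : v 0 = v₀
  continuousOn : ∀ T : ℝ, 0 < T → ContinuousOn v (Icc 0 T)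
  equation : ∀ T : ℝ, 0 < T → ∃ u : ℝ → G.Sobolev p, G.MemLpTime T u ∧
    (∀ᵐ t ∂(volume.restrict (Ioo 0 T)), ∀ e,
      v t e =ᵐ[G.edgeMeasure e] fun x => γ e (Sobolev.fn (u t) e x)) ∧
    ∀ (ψ ψ' : ℝ → G.SobolevOne) (ψp : ℝ → G.Sobolev p), G.IsEvolutionTest T ψ ψ' ψp →
      - (∫ t in Ioo 0 T, G.pairing (v t) (ψ' t)) + ∫ t in Ioo 0 T, G.pLaplaceForm p (u t) (ψp t)
        = (∫ t in Ioo 0 T, G.pairing (f t) (ψ t))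
          + ∑ a, ∫ t in Ioo 0 T, ω t a * Sobolev.vertexValue (ψ t) a

end CompactMetricGraph

end

/-!
Fix `x = (γ(w), 0)` and `y` with `(x, y)` in the elliptic operator, and put `F = (f, ω)`. Let `S` be
a smooth approximation of the sign function. There is a convex approximation `J` of the distance
`‖· - x‖` whose subgradient at `W(s) = (γ(u(s)), 0)` is `S(u(s) - w)`. Testing the equation,
integrated over `[s - h, s]`, with this one function bounds `J(W(s)) - J(W(s - h))` from above, and
no chain rule in time is needed. Replacing the source at the times `τ ∈ [s - h, s]` by the source
at time `s` costs the oscillation of `F` in `L¹` and that of the fluxes `|u'|^{p-2} u'` in the dual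
exponents, which is `o(h)` in the mean over `s` by the continuity of translations.

Subtracting the elliptic equation of `w`, the monotonicity of the `p`-Laplacian leaves the pairing
of `F(s) - y` with the subgradient, and convexity bounds it by the difference quotient
`(J(W(s) + r (F(s) - y)) - J(W(s))) / r` for every `r > 0`. Divide by `h` and let `h ↓ 0`, then let
`S` tend to the sign function, so that `J` tends to the distance to `x`, and finally let `r ↓ 0`:
the difference quotient decreases to the bracket.
-/

/-! ### Test functions and weak derivatives on an interval -/

namespace IsScalarTest

variable {a b : ℝ} {φ ψ : ℝ → ℝ}

theorem eq_zero (h : IsScalarTest a b φ) {x : ℝ} (hx : x ∉ Ioo a b) : φ x = 0 :=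
  image_eq_zero_of_notMem_tsupport fun hx' => hx (h.support hx')

theorem continuous_deriv (h : IsScalarTest a b φ) : Continuous (deriv φ) :=
  h.smooth.continuous_deriv (by simp)

theorem absolutelyContinuousOnInterval (h : IsScalarTest a b φ) :
    AbsolutelyContinuousOnInterval φ a b :=
  (h.smooth.of_le (by exact_mod_cast le_top)).contDiffOn.absolutelyContinuousOnInterval

theorem const_mul (h : IsScalarTest a b φ) (k : ℝ) : IsScalarTest a b fun x => k * φ x where
  smooth := contDiff_const.mul h.smooth
  compact := h.compact.mul_left (f := fun _ => k)
  support := (tsupport_mul_subset_right (f := fun _ => k) (g := φ)).trans h.support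

theorem sub (h : IsScalarTest a b φ) (hψ : IsScalarTest a b ψ) :
    IsScalarTest a b fun x => φ x - ψ x where
  smooth := h.smooth.sub hψ.smooth
  compact := h.compact.sub hψ.compact
  support := (tsupport_sub _ _).trans (union_subset h.support hψ.support)

theorem integrable_smul (h : IsScalarTest a b φ) {F : Type*} [NormedAddCommGroup F]
    [NormedSpace ℝ F] {μ : Measure ℝ} {u : ℝ → F} (hu : Integrable u μ) :
    Integrable (fun x => φ x • u x) μ :=
  let ⟨C, hC⟩ := h.compact.exists_bound_of_continuous h.smooth.continuous
  hu.bdd_smul C h.smooth.continuous.aestronglyMeasurable (ae_of_all _ hC)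

theorem integrable_deriv_smul (h : IsScalarTest a b φ) {F : Type*} [NormedAddCommGroup F]
    [NormedSpace ℝ F] {μ : Measure ℝ} {u : ℝ → F} (hu : Integrable u μ) :
    Integrable (fun x => deriv φ x • u x) μ :=
  let ⟨C, hC⟩ := h.compact.deriv.exists_bound_of_continuous h.continuous_deriv
  hu.bdd_smul C h.continuous_deriv.aestronglyMeasurable (ae_of_all _ hC)

theorem integrableOn (h : IsScalarTest a b φ) : IntegrableOn φ (Ioo a b) :=
  (h.smooth.continuous.integrable_of_hasCompactSupport h.compact).integrableOn

theorem exists_Icc (h : IsScalarTest a b φ) (hab : a < b) :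
    ∃ c d, a < c ∧ c ≤ d ∧ d < b ∧ ∀ x, x ∉ Icc c d → φ x = 0 := by
  have hK : IsCompact (insert ((a + b) / 2) (tsupport φ)) := h.compact.isCompact.insert _
  have hsub : insert ((a + b) / 2) (tsupport φ) ⊆ Ioo a b :=
    insert_subset ⟨by linarith, by linarith⟩ h.support
  have hne : (insert ((a + b) / 2) (tsupport φ)).Nonempty := insert_nonempty _ _
  refine ⟨_, _, (hsub (hK.sInf_mem hne)).1, csInf_le_csSup hne hK.bddBelow hK.bddAbove,
    (hsub (hK.sSup_mem hne)).2, fun x hx => image_eq_zero_of_notMem_tsupport fun hx' => hx ?_⟩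
  exact ⟨csInf_le hK.bddBelow (mem_insert_of_mem _ hx'),
    le_csSup hK.bddAbove (mem_insert_of_mem _ hx')⟩

theorem of_Icc {c d : ℝ} (hφ : ContDiff ℝ ((⊤ : ℕ∞) : WithTop ℕ∞) φ) (hac : a < c) (hdb : d < b)
    (h : ∀ x, x ∉ Icc c d → φ x = 0) : IsScalarTest a b φ := by
  have hs : tsupport φ ⊆ Icc c d :=
    closure_minimal (fun x hx => by_contra fun hx' => hx (h x hx')) isClosed_Icc
  exact ⟨hφ, isCompact_Icc.of_isClosed_subset (isClosed_tsupport _) hs,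
    hs.trans (Icc_subset_Ioo hac hdb)⟩

theorem exists_deriv_eq (h : IsScalarTest a b φ) (hab : a < b)
    (h0 : ∫ x in Ioo a b, φ x = 0) : ∃ ψ, IsScalarTest a b ψ ∧ deriv ψ = φ := by
  obtain ⟨c, d, hac, -, hdb, hout⟩ := h.exists_Icc hab
  have hcont := h.smooth.continuous
  have hderiv : ∀ x, HasDerivAt (fun x => ∫ t in a..x, φ t) (φ x) x :=
    fun x => (hcont.integral_hasStrictDerivAt a x).hasDerivAt
  have hderiv_eq : deriv (fun x => ∫ t in a..x, φ t) = φ := funext fun x => (hderiv x).deriv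
  have hvanish : ∀ x y, (∀ t ∈ uIoc x y, t ∉ Icc c d) → ∫ t in x..y, φ t = 0 := fun x y hxy =>
    intervalIntegral.integral_zero_ae (ae_of_all _ fun t ht => hout t (hxy t ht))
  have htotal : ∫ t in a..b, φ t = 0 := by
    rw [intervalIntegral.integral_of_le hab.le, integral_Ioc_eq_integral_Ioo, h0]
  refine ⟨_, of_Icc (c := c) (d := d) ?_ hac hdb fun x hx => ?_, hderiv_eq⟩
  · exact contDiff_infty_iff_deriv.2
      ⟨fun x => (hderiv x).differentiableAt, hderiv_eq.symm ▸ h.smooth⟩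
  rcases lt_or_ge x c with hxc | hcx
  · exact hvanish a x fun t ht ht' => by
      rcases mem_uIoc.1 ht with ht | ht <;> linarith [ht.2, ht'.1]
  · have hdx : d < x := not_le.1 fun hxd => hx ⟨hcx, hxd⟩
    change ∫ t in a..x, φ t = 0
    rw [← intervalIntegral.integral_add_adjacent_intervals (hcont.intervalIntegrable a b)
      (hcont.intervalIntegrable b x), htotal, zero_add]
    exact hvanish b x fun t ht ht' => by
      rcases mem_uIoc.1 ht with ht | ht <;> linarith [ht.1, ht'.2]

end IsScalarTest

theorem exists_isScalarTest_integral_eq_one {a b : ℝ} (hab : a < b) :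
    ∃ φ : ℝ → ℝ, IsScalarTest a b φ ∧ ∫ x in Ioo a b, φ x = 1 := by
  let B : ContDiffBump ((a + b) / 2) := ⟨(b - a) / 8, (b - a) / 4, by linarith, by linarith⟩
  have hφ : IsScalarTest a b (B.normed volume) := by
    refine IsScalarTest.of_Icc (c := (a + b) / 2 - (b - a) / 4) (d := (a + b) / 2 + (b - a) / 4)
      B.contDiff_normed (by linarith) (by linarith) fun x hx => ?_
    refine image_eq_zero_of_notMem_tsupport fun hx' => hx ?_
    rwa [B.tsupport_normed_eq, Real.closedBall_eq_Icc] at hx'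
  refine ⟨_, hφ, ?_⟩
  rw [setIntegral_eq_integral_of_forall_compl_eq_zero fun x hx => hφ.eq_zero hx]
  exact B.integral_normed

theorem IsScalarTest.exists_deriv_eq_sub {a b : ℝ} (hab : a < b) {φ φ₀ : ℝ → ℝ}
    (hφ : IsScalarTest a b φ) (hφ₀ : IsScalarTest a b φ₀) (hφ₀_one : ∫ x in Ioo a b, φ₀ x = 1) :
    ∃ ψ, IsScalarTest a b ψ ∧ ∀ x, deriv ψ x = φ x - (∫ x in Ioo a b, φ x) * φ₀ x := by
  obtain ⟨ψ, hψ, hψ_deriv⟩ := (hφ.sub (hφ₀.const_mul (∫ x in Ioo a b, φ x))).exists_deriv_eq hab (by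
    rw [integral_sub hφ.integrableOn (hφ₀.integrableOn.const_mul _), integral_const_mul, hφ₀_one,
      mul_one, sub_self])
  exact ⟨ψ, hψ, congrFun hψ_deriv⟩

namespace HasWeakDeriv

variable {F : Type*} [NormedAddCommGroup F] [NormedSpace ℝ F] [CompleteSpace F] {a b : ℝ}

theorem congr {u u' g g' : ℝ → F} (h : HasWeakDeriv a b u g)
    (hu : u =ᵐ[volume.restrict (Ioo a b)] u') (hg : g =ᵐ[volume.restrict (Ioo a b)] g') :
    HasWeakDeriv a b u' g' := fun φ hφ => by
  rw [← integral_congr_ae (hu.mono fun x hx => congrArg (deriv φ x • ·) hx),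
    ← integral_congr_ae (hg.mono fun x hx => congrArg (φ x • ·) hx)]
  exact h φ hφ

theorem sub {u u' g g' : ℝ → F} (hu : IntegrableOn u (Ioo a b)) (hu' : IntegrableOn u' (Ioo a b))
    (hg : IntegrableOn g (Ioo a b)) (hg' : IntegrableOn g' (Ioo a b)) (h : HasWeakDeriv a b u g)
    (h' : HasWeakDeriv a b u' g') :
    HasWeakDeriv a b (fun x => u x - u' x) (fun x => g x - g' x) := fun φ hφ => by
  simp only [smul_sub]
  rw [integral_sub (hφ.integrable_deriv_smul hu) (hφ.integrable_deriv_smul hu'),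
    integral_sub (hφ.integrable_smul hg) (hφ.integrable_smul hg'), h φ hφ, h' φ hφ]
  abel

theorem smul_const {u g : ℝ → ℝ} (h : HasWeakDeriv a b u g) (y : F) :
    HasWeakDeriv a b (fun x => u x • y) (fun x => g x • y) := fun φ hφ => by
  simp only [← smul_assoc]
  rw [integral_smul_const, integral_smul_const, h φ hφ, neg_smul]

theorem ae_eq_const {u : ℝ → F} (hab : a < b) (hu : IntegrableOn u (Ioo a b))
    (h : HasWeakDeriv a b u 0) : ∃ c, u =ᵐ[volume.restrict (Ioo a b)] fun _ => c := by
  obtain ⟨φ₀, hφ₀, hφ₀_one⟩ := exists_isScalarTest_integral_eq_one hab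
  set c := ∫ x in Ioo a b, φ₀ x • u x
  have hdiff : ∀ᵐ x, x ∈ Ioo a b → u x - c = 0 := by
    refine isOpen_Ioo.ae_eq_zero_of_integral_contDiff_smul_eq_zero
      (hu.sub (by simp : IntegrableOn (fun _ => c) (Ioo a b))).locallyIntegrableOn
      fun φ hsmooth hcompact hsupport => ?_
    have hφ : IsScalarTest a b φ := ⟨hsmooth, hcompact, hsupport⟩
    obtain ⟨ψ, hψ, hψ_deriv⟩ := hφ.exists_deriv_eq_sub hab hφ₀ hφ₀_one
    calc ∫ x, φ x • (u x - c) = ∫ x in Ioo a b, φ x • (u x - c) :=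
          (setIntegral_eq_integral_of_forall_compl_eq_zero fun x hx => by
            rw [hφ.eq_zero hx, zero_smul]).symm
      _ = (∫ x in Ioo a b, φ x • u x) - (∫ x in Ioo a b, φ x) • c := by
          simp only [smul_sub]
          rw [integral_sub (hφ.integrable_smul hu) (hφ.integrableOn.smul_const c),
            integral_smul_const]
      _ = ∫ x in Ioo a b, deriv ψ x • u x := by
          simp only [hψ_deriv, sub_smul, mul_smul]
          rw [integral_sub (hφ.integrable_smul hu)
            ((hφ₀.integrable_smul hu).fun_smul (∫ x in Ioo a b, φ x)), integral_smul]
      _ = 0 := by simpa using h ψ hψ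
  refine ⟨c, ?_⟩
  rw [Filter.EventuallyEq, ae_restrict_iff' measurableSet_Ioo]
  exact hdiff.mono fun x hx hmem => sub_eq_zero.1 (hx hmem)

theorem of_absolutelyContinuousOnInterval (hab : a ≤ b) {u : ℝ → ℝ}
    (hu : AbsolutelyContinuousOnInterval u a b) : HasWeakDeriv a b u (deriv u) := fun φ hφ => by
  have := hφ.absolutelyContinuousOnInterval.integral_mul_deriv_eq_deriv_mul hu
  rw [hφ.eq_zero (by simp), hφ.eq_zero (by simp), intervalIntegral.integral_of_le hab,
    intervalIntegral.integral_of_le hab, integral_Ioc_eq_integral_Ioo,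
    integral_Ioc_eq_integral_Ioo] at this
  simp only [smul_eq_mul]
  linarith

end HasWeakDeriv

theorem IsScalarTest.hasWeakDeriv {a b : ℝ} (hab : a ≤ b) {φ : ℝ → ℝ} (h : IsScalarTest a b φ) :
    HasWeakDeriv a b φ (deriv φ) :=
  .of_absolutelyContinuousOnInterval hab h.absolutelyContinuousOnInterval

section Primitive

variable {a b : ℝ} {g : ℝ → ℝ}

theorem intervalIntegrable_of_integrableOn_Ioo {a b : ℝ} (hab : a ≤ b) {F : Type*}
    [NormedAddCommGroup F] {g : ℝ → F} (hg : IntegrableOn g (Ioo a b)) :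
    IntervalIntegrable g volume a b :=
  (intervalIntegrable_iff_integrableOn_Ioo_of_le hab).2 hg

theorem absolutelyContinuousOnInterval_const_add_integral (hab : a ≤ b)
    (hg : IntegrableOn g (Ioo a b)) (c : ℝ) :
    AbsolutelyContinuousOnInterval (fun x => c + ∫ t in a..x, g t) a b :=
  (LipschitzWith.const c).lipschitzOnWith.absolutelyContinuousOnInterval.add
    ((intervalIntegrable_of_integrableOn_Ioo hab hg).absolutelyContinuousOnInterval_intervalIntegral
      left_mem_uIcc)

theorem ae_hasDerivAt_const_add_integral (hab : a ≤ b) (hg : IntegrableOn g (Ioo a b)) (c : ℝ) :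
    ∀ᵐ x ∂(volume.restrict (Ioo a b)), HasDerivAt (fun x => c + ∫ t in a..x, g t) (g x) x := by
  rw [ae_restrict_iff' measurableSet_Ioo]
  filter_upwards [(intervalIntegrable_of_integrableOn_Ioo hab hg).ae_hasDerivAt_integral]
    with x hx hmem
  have hmem_Icc : x ∈ uIcc a b := uIcc_of_le hab ▸ Ioo_subset_Icc_self hmem
  exact (hx hmem_Icc a left_mem_uIcc).const_add c

theorem hasWeakDeriv_const_add_integral (hab : a ≤ b) (hg : IntegrableOn g (Ioo a b)) (c : ℝ) :
    HasWeakDeriv a b (fun x => c + ∫ t in a..x, g t) g :=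
  (HasWeakDeriv.of_absolutelyContinuousOnInterval hab
    (absolutelyContinuousOnInterval_const_add_integral hab hg c)).congr EventuallyEq.rfl
      ((ae_hasDerivAt_const_add_integral hab hg c).mono fun _ hx => hx.deriv)

theorem HasWeakDeriv.exists_eq_const_add_integral (hab : a < b) {u : ℝ → ℝ}
    (hu : IntegrableOn u (Ioo a b)) (hg : IntegrableOn g (Ioo a b)) (h : HasWeakDeriv a b u g) :
    ∃ c, u =ᵐ[volume.restrict (Ioo a b)] fun x => c + ∫ t in a..x, g t := by
  have hprimitive : IntegrableOn (fun x => 0 + ∫ t in a..x, g t) (Ioo a b) :=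
    (uIcc_of_le hab.le ▸ (absolutelyContinuousOnInterval_const_add_integral hab.le hg
      0).continuousOn).integrableOn_Icc.mono_set Ioo_subset_Icc_self
  obtain ⟨c, hc⟩ := HasWeakDeriv.ae_eq_const hab (hu.sub hprimitive)
    ((HasWeakDeriv.sub hu hprimitive hg hg h (hasWeakDeriv_const_add_integral hab.le hg 0)).congr
      EventuallyEq.rfl (ae_of_all _ fun x => sub_self (g x)))
  exact ⟨c, hc.mono fun x hx => by linarith [show u x - (0 + ∫ t in a..x, g t) = c from hx]⟩

theorem HasWeakDeriv.sub_eq_integral (hab : a < b) {u : ℝ → ℝ} (hu : ContinuousOn u (Icc a b))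
    (hg : IntegrableOn g (Ioo a b)) (h : HasWeakDeriv a b u g) {s t : ℝ} (hs : s ∈ Icc a b)
    (ht : t ∈ Icc a b) : u t - u s = ∫ x in s..t, g x := by
  obtain ⟨c, hc⟩ :=
    h.exists_eq_const_add_integral hab (hu.integrableOn_Icc.mono_set Ioo_subset_Icc_self) hg
  have hprimitive := (absolutelyContinuousOnInterval_const_add_integral hab.le hg c).continuousOn
  rw [uIcc_of_le hab.le] at hprimitive
  have heq : EqOn u (fun x => c + ∫ t in a..x, g t) (Icc a b) :=
    Measure.eqOn_Icc_of_ae_eq (μ := volume) hab.ne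
      (by rwa [← restrict_Ioo_eq_restrict_Icc]) hu hprimitive
  have hint : ∀ x ∈ Icc a b, IntervalIntegrable g volume a x := fun x hx =>
    (intervalIntegrable_of_integrableOn_Ioo hab.le hg).mono_set
      (uIcc_subset_uIcc_left (Icc_subset_uIcc hx))
  rw [heq hs, heq ht, add_sub_add_left_eq_sub,
    intervalIntegral.integral_interval_sub_left (hint t ht) (hint s hs)]

theorem absolutelyContinuousOnInterval_lipschitz_comp {X Y : Type*} [PseudoMetricSpace X]
    [PseudoMetricSpace Y] {u : ℝ → X} (hu : AbsolutelyContinuousOnInterval u a b) {S : X → Y}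
    {K : NNReal} (hS : LipschitzWith K S) :
    AbsolutelyContinuousOnInterval (fun x => S (u x)) a b := by
  unfold AbsolutelyContinuousOnInterval at hu ⊢
  refine squeeze_zero (fun _ => Finset.sum_nonneg fun _ _ => dist_nonneg) (fun I => ?_)
    (mul_zero (K : ℝ) ▸ hu.const_mul (K : ℝ))
  rw [Finset.mul_sum]
  exact Finset.sum_le_sum fun i _ => hS.dist_le_mul _ _

theorem hasWeakDeriv_comp_const_add_integral (hab : a ≤ b) (hg : IntegrableOn g (Ioo a b)) (c : ℝ)
    {S : ℝ → ℝ} {K : NNReal} (hS : LipschitzWith K S) (hS' : Differentiable ℝ S) :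
    HasWeakDeriv a b (fun x => S (c + ∫ t in a..x, g t))
      (fun x => deriv S (c + ∫ t in a..x, g t) * g x) :=
  (HasWeakDeriv.of_absolutelyContinuousOnInterval hab
    (absolutelyContinuousOnInterval_lipschitz_comp
      (absolutelyContinuousOnInterval_const_add_integral hab hg c) hS)).congr EventuallyEq.rfl
    ((ae_hasDerivAt_const_add_integral hab hg c).mono fun _ hx =>
      ((hS' _).hasDerivAt.comp _ hx).deriv)

end Primitive

/-! ### Backward differences in time -/

section BackwardDifference

variable {F : Type*} [NormedAddCommGroup F] {T : ℝ}

theorem tendsto_eLpNorm_translate_sub {q : ℝ≥0∞} (hq_one : 1 ≤ q) (hq_top : q ≠ ∞) {f : ℝ → F}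
    (hf : MemLp f q volume) :
    Tendsto (fun σ : ℝ => eLpNorm (fun s => f (s - σ) - f s) q volume) (𝓝 0) (𝓝 0) := by
  have : Fact (1 ≤ q) := ⟨hq_one⟩
  have : Fact (q ≠ ∞) := ⟨hq_top⟩
  have hcont : Continuous fun σ : ℝ => DomAddAct.mk (-σ) +ᵥ hf.toLp f :=
    (DomAddAct.continuous_mk.comp continuous_neg).vadd continuous_const
  have hlim := hcont.tendsto 0
  rw [neg_zero, DomAddAct.mk_zero, zero_vadd] at hlim
  refine ((Lp.tendsto_Lp_iff_tendsto_eLpNorm'' (fun σ : ℝ => fun s => f (-σ +ᵥ s))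
    (fun σ => hf.comp_measurePreserving (measurePreserving_vadd (-σ) volume)) f hf).1 hlim).congr
    fun σ => ?_
  simp only [Pi.sub_def, vadd_eq_add, neg_add_eq_sub]

/-- The oscillation `∫₀ʰ ‖f(s - σ) - f(s)‖ dσ` of `f` on the time interval of length `h` that ends
at `s`. -/
noncomputable def backwardOsc (f : ℝ → F) (s h : ℝ) : ℝ≥0∞ := ∫⁻ σ in Ioo 0 h, ‖f (s - σ) - f s‖ₑ

/-- A family of remainders `R(·, h)` with `∫ₕᵀ R(s, h) ds = o(h)` as `h ↓ 0`. -/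
structure IsMeanNegligible (T : ℝ) (R : ℝ → ℝ → ℝ≥0∞) : Prop where
  aemeasurable : ∀ h, 0 < h → AEMeasurable (R · h) (volume.restrict (Ioo h T))
  tendsto : Tendsto (fun h => (∫⁻ s in Ioo h T, R s h) / ENNReal.ofReal h) (𝓝[>] 0) (𝓝 0)

namespace IsMeanNegligible

theorem zero : IsMeanNegligible T 0 where
  aemeasurable _ _ := aemeasurable_const
  tendsto := by simp

theorem add {R R' : ℝ → ℝ → ℝ≥0∞} (hR : IsMeanNegligible T R) (hR' : IsMeanNegligible T R') :
    IsMeanNegligible T (R + R') where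
  aemeasurable h hh := (hR.aemeasurable h hh).add (hR'.aemeasurable h hh)
  tendsto := by
    refine (add_zero (0 : ℝ≥0∞) ▸ hR.tendsto.add hR'.tendsto).congr' ?_
    filter_upwards [self_mem_nhdsWithin] with h hh
    rw [← ENNReal.add_div, ← lintegral_add_left' (hR.aemeasurable h hh)]
    rfl

theorem sum {ι : Type*} (I : Finset ι) {R : ι → ℝ → ℝ → ℝ≥0∞}
    (hR : ∀ i, IsMeanNegligible T (R i)) : IsMeanNegligible T (∑ i ∈ I, R i) :=
  Finset.sum_induction _ _ (fun _ _ => add) zero fun i _ => hR i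

end IsMeanNegligible

section Translation

variable {H : Type*} [NormedAddCommGroup H] {q q' : ℝ≥0∞} [q'.HolderConjugate q]

theorem lintegral_enorm_mul_enorm_le {α : Type*} [MeasurableSpace α] {μ : Measure α} {M : α → H}
    {f : α → F} (hM : AEStronglyMeasurable M μ) (hf : AEStronglyMeasurable f μ) :
    ∫⁻ x, ‖M x‖ₑ * ‖f x‖ₑ ∂μ ≤ eLpNorm M q' μ * eLpNorm f q μ := by
  have := eLpNorm_smul_le_mul_eLpNorm (p := q') (q := q) (r := 1) hf.norm hM.norm
  simpa only [eLpNorm_one_eq_lintegral_enorm, Pi.mul_apply, smul_eq_mul, enorm_mul, enorm_norm,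
    eLpNorm_norm] using this

theorem aemeasurable_uncurry_enorm_mul_translate_sub {M : ℝ → H} {f : ℝ → F}
    (hM : AEStronglyMeasurable M volume) (hf : AEStronglyMeasurable f volume) (h : ℝ) :
    AEMeasurable (Function.uncurry fun s σ : ℝ => ‖M s‖ₑ * ‖f (s - σ) - f s‖ₑ)
      ((volume : Measure ℝ).prod (volume.restrict (Ioo 0 h))) :=
  (hM.comp_quasiMeasurePreserving Measure.quasiMeasurePreserving_fst).enorm.mul
    ((hf.comp_quasiMeasurePreserving (quasiMeasurePreserving_sub _ _)).sub
      (hf.comp_quasiMeasurePreserving Measure.quasiMeasurePreserving_fst)).enorm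

theorem lintegral_enorm_mul_backwardOsc_le {M : ℝ → H} {f : ℝ → F}
    (hM : AEStronglyMeasurable M volume) (hf : AEStronglyMeasurable f volume) (h : ℝ) :
    ∫⁻ s, ‖M s‖ₑ * backwardOsc f s h
      ≤ ∫⁻ σ in Ioo 0 h, eLpNorm M q' volume * eLpNorm (fun s => f (s - σ) - f s) q volume := by
  simp only [backwardOsc, ← lintegral_const_mul' _ _ enorm_ne_top]
  rw [lintegral_lintegral_swap (aemeasurable_uncurry_enorm_mul_translate_sub hM hf h)]
  exact lintegral_mono fun σ => lintegral_enorm_mul_enorm_le hM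
    ((hf.comp_measurePreserving (measurePreserving_sub_right volume σ)).sub hf)

theorem tendsto_lintegral_enorm_mul_backwardOsc_div (hq : q ≠ ∞) {M : ℝ → H} {f : ℝ → F}
    (hM : MemLp M q' volume) (hf : MemLp f q volume) :
    Tendsto (fun h => (∫⁻ s, ‖M s‖ₑ * backwardOsc f s h) / ENNReal.ofReal h)
      (𝓝[>] 0) (𝓝 0) := by
  rw [ENNReal.tendsto_nhds_zero]
  intro ε hε
  have hlim : Tendsto (fun σ : ℝ => eLpNorm M q' volume *
      eLpNorm (fun s => f (s - σ) - f s) q volume) (𝓝 0) (𝓝 0) :=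
    mul_zero (eLpNorm M q' volume) ▸ ENNReal.Tendsto.const_mul
      (tendsto_eLpNorm_translate_sub (ENNReal.HolderConjugate.one_le q q') hq hf)
      (Or.inr hM.2.ne)
  obtain ⟨δ, hδ, hball⟩ := Metric.eventually_nhds_iff.1 (ENNReal.tendsto_nhds_zero.1 hlim ε hε)
  filter_upwards [Ioo_mem_nhdsGT hδ] with h hh
  refine ENNReal.div_le_of_le_mul ?_
  calc ∫⁻ s, ‖M s‖ₑ * backwardOsc f s h
      ≤ ∫⁻ σ in Ioo 0 h, eLpNorm M q' volume * eLpNorm (fun s => f (s - σ) - f s) q volume :=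
        lintegral_enorm_mul_backwardOsc_le hM.1 hf.1 h
    _ ≤ ∫⁻ _ in Ioo 0 h, ε := setLIntegral_mono measurable_const fun σ hσ => hball (by
        rw [Real.dist_eq, sub_zero, abs_of_pos hσ.1]; exact hσ.2.trans hh.2)
    _ = ε * ENNReal.ofReal h := by simp

theorem isMeanNegligible_enorm_mul_backwardOsc (hq : q ≠ ∞) {M : ℝ → H} {f : ℝ → F}
    (hM : MemLp M q' (volume.restrict (Ioo 0 T))) (hf : MemLp f q (volume.restrict (Ioo 0 T))) :
    IsMeanNegligible T fun s h => ‖M s‖ₑ * backwardOsc f s h := by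
  have hM' := (memLp_indicator_iff_restrict measurableSet_Ioo).2 hM
  have hf' := (memLp_indicator_iff_restrict measurableSet_Ioo).2 hf
  have heq : ∀ h, 0 < h → ∀ s ∈ Ioo h T, ‖(Ioo 0 T).indicator M s‖ₑ
      * backwardOsc ((Ioo 0 T).indicator f) s h = ‖M s‖ₑ * backwardOsc f s h := fun h hh s hs => by
    have hmem : s ∈ Ioo 0 T := ⟨hh.trans hs.1, hs.2⟩
    rw [indicator_of_mem hmem]
    refine congrArg (‖M s‖ₑ * ·) (setLIntegral_congr_fun measurableSet_Ioo fun σ hσ => ?_)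
    have hmem' : s - σ ∈ Ioo 0 T := ⟨by linarith [hσ.2, hs.1], by linarith [hσ.1, hs.2]⟩
    simp only [indicator_of_mem hmem, indicator_of_mem hmem']
  refine ⟨fun h hh => ?_, ?_⟩
  · refine AEMeasurable.congr ?_ ((ae_restrict_iff' measurableSet_Ioo).2 (ae_of_all _ (heq h hh)))
    simp only [backwardOsc, ← lintegral_const_mul' _ _ enorm_ne_top]
    exact (aemeasurable_uncurry_enorm_mul_translate_sub hM'.1 hf'.1
      h).lintegral_prod_right'.restrict
  · refine tendsto_of_tendsto_of_tendsto_of_le_of_le' tendsto_const_nhds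
      (tendsto_lintegral_enorm_mul_backwardOsc_div hq hM' hf') (Eventually.of_forall fun _ =>
        zero_le) ?_
    filter_upwards [self_mem_nhdsWithin] with h hh
    rw [← setLIntegral_congr_fun measurableSet_Ioo (heq h hh)]
    exact ENNReal.div_le_div_right (setLIntegral_le_lintegral _ _) _

end Translation

theorem tendsto_integral_mul_sub_translate_div {ξ g : ℝ → ℝ} (hξ : ContDiff ℝ 1 ξ)
    (hξ_compact : HasCompactSupport ξ) (hg : Continuous g) :
    Tendsto (fun h => (∫ s, ξ s * (g s - g (s - h))) / h) (𝓝[>] 0)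
      (𝓝 (-∫ s, g s * deriv ξ s)) := by
  have hg_neg : Continuous fun y => g (-y) := hg.comp continuous_neg
  have hconv : ∀ h : ℝ, MeasureTheory.convolution ξ (fun y => g (-y))
      (ContinuousLinearMap.mul ℝ ℝ) volume h = ∫ s, ξ s * g (s - h) := fun h => by
    simp only [MeasureTheory.convolution, ContinuousLinearMap.mul_apply', neg_sub]
  have hconv_deriv : MeasureTheory.convolution (deriv ξ) (fun y => g (-y))
      (ContinuousLinearMap.mul ℝ ℝ) volume 0 = ∫ s, g s * deriv ξ s := by
    simp only [MeasureTheory.convolution, ContinuousLinearMap.mul_apply', neg_sub, sub_zero,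
      mul_comm]
  have hderiv := hξ_compact.hasDerivAt_convolution_left (ContinuousLinearMap.mul ℝ ℝ)
    (μ := volume) hξ hg_neg.locallyIntegrable 0
  have hslope := ((hasDerivAt_iff_tendsto_slope.1 hderiv).mono_left
    (nhdsWithin_mono 0 fun x (hx : 0 < x) => hx.ne')).neg
  have hint : ∀ h : ℝ, Integrable fun s => ξ s * g (s - h) := fun h =>
    (hξ.continuous.mul (hg.comp (continuous_id.sub
      continuous_const))).integrable_of_hasCompactSupport hξ_compact.mul_right
  rw [hconv_deriv] at hslope
  refine hslope.congr fun h => ?_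
  rw [slope_def_field, hconv, hconv, ← neg_div, neg_sub,
    ← integral_sub (hint 0) (hint h)]
  simp only [mul_sub, sub_zero]

theorem integral_le_toReal_lintegral_ofReal {α : Type*} [MeasurableSpace α] {μ : Measure α}
    {f : α → ℝ} (hf : Integrable f μ) : ∫ x, f x ∂μ ≤ (∫⁻ x, ENNReal.ofReal (f x) ∂μ).toReal := by
  rw [integral_eq_lintegral_pos_part_sub_lintegral_neg_part hf]
  exact sub_le_self _ ENNReal.toReal_nonneg

theorem integral_mul_sub_translate_div_le {g ρ ξ : ℝ → ℝ} {r : ℝ → ℝ≥0∞} {C h : ℝ}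
    (hg : Continuous g) (hρ : IntegrableOn ρ (Ioo 0 T)) (hξ : IsScalarTest 0 T ξ)
    (hξ_nonneg : ∀ t, 0 ≤ ξ t) (hξ_le : ∀ t, ξ t ≤ C) (hh : 0 < h) (hξ_zero : ∀ t ≤ h, ξ t = 0)
    (hr : (∫⁻ s in Ioo h T, r s) / ENNReal.ofReal h ≠ ∞)
    (hle : ∀ᵐ s ∂(volume.restrict (Ioo h T)),
      ENNReal.ofReal (g s - g (s - h) - h * ρ s) ≤ r s) :
    (∫ s, ξ s * (g s - g (s - h))) / h
      ≤ (∫ s in Ioo 0 T, ρ s * ξ s) + C * ((∫⁻ s in Ioo h T, r s) / ENNReal.ofReal h).toReal := by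
  have hsupport : ∀ s ∉ Ioo h T, ξ s = 0 := fun s hs => by
    rcases le_or_gt s h with hsh | hhs
    · exact hξ_zero s hsh
    · exact hξ.eq_zero fun hmem => hs ⟨hhs, hmem.2⟩
  have hint_diff : Integrable fun s => ξ s * (g s - g (s - h)) :=
    (hξ.smooth.continuous.mul (hg.sub (hg.comp (continuous_id.sub
      continuous_const)))).integrable_of_hasCompactSupport hξ.compact.mul_right
  have hint_rate : IntegrableOn (fun s => h * (ρ s * ξ s)) (Ioo h T) :=
    IntegrableOn.mono_set (((hξ.integrable_mul hρ).1.congr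
      (ae_of_all _ fun t => mul_comm _ _)).const_mul h) (Ioo_subset_Ioo_left hh.le)
  have hlintegral : ∫⁻ s in Ioo h T, ENNReal.ofReal (ξ s * (g s - g (s - h)) - h * (ρ s * ξ s))
      ≤ ENNReal.ofReal C * ∫⁻ s in Ioo h T, r s := by
    rw [← lintegral_const_mul' _ _ ENNReal.ofReal_ne_top]
    refine lintegral_mono_ae (hle.mono fun s hs => ?_)
    rw [show ξ s * (g s - g (s - h)) - h * (ρ s * ξ s) = ξ s * (g s - g (s - h) - h * ρ s) by ring,
      ENNReal.ofReal_mul (hξ_nonneg s)]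
    exact mul_le_mul' (ENNReal.ofReal_le_ofReal (hξ_le s)) hs
  have hC : 0 ≤ C := (hξ_nonneg 0).trans (hξ_le 0)
  have hfinite : ∫⁻ s in Ioo h T, r s ≠ ∞ := fun htop => hr (by
    rw [htop, ENNReal.top_div_of_ne_top ENNReal.ofReal_ne_top])
  have hreal := (integral_le_toReal_lintegral_ofReal (hint_diff.integrableOn.sub hint_rate)).trans
    (ENNReal.toReal_mono (ENNReal.mul_ne_top ENNReal.ofReal_ne_top hfinite) hlintegral)
  simp only [Pi.sub_apply] at hreal
  rw [integral_sub hint_diff.integrableOn hint_rate, integral_const_mul, ENNReal.toReal_mul,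
    ENNReal.toReal_ofReal hC, setIntegral_eq_integral_of_forall_compl_eq_zero fun s hs => by
      rw [hsupport s hs, zero_mul]] at hreal
  have hrate : ∫ s in Ioo 0 T, ρ s * ξ s = ∫ s in Ioo h T, ρ s * ξ s :=
    (setIntegral_eq_of_subset_of_forall_sdiff_eq_zero measurableSet_Ioo
      (Ioo_subset_Ioo_left hh.le) fun s hs => by rw [hsupport s hs.2, mul_zero])
  rw [ENNReal.toReal_div, ENNReal.toReal_ofReal hh.le, hrate, div_le_iff₀ hh, add_mul, mul_assoc C,
    div_mul_cancel₀ _ hh.ne']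
  linarith

/-- The inequality `g' ≤ ρ` in `𝒟'(]0, T[)`, tested with nonnegative functions. -/
def DistribDerivLE (T : ℝ) (g ρ : ℝ → ℝ) : Prop :=
  ∀ ξ : ℝ → ℝ, IsScalarTest 0 T ξ → (∀ t, 0 ≤ ξ t) →
    -∫ t in Ioo 0 T, g t * deriv ξ t ≤ ∫ t in Ioo 0 T, ρ t * ξ t

theorem DistribDerivLE.of_backward_difference_le {g ρ : ℝ → ℝ} {R : ℝ → ℝ → ℝ≥0∞} (hT : 0 < T)
    (hg : ContinuousOn g (Icc 0 T)) (hρ : IntegrableOn ρ (Ioo 0 T)) (hR : IsMeanNegligible T R)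
    (hle : ∀ h, 0 < h → ∀ᵐ s ∂(volume.restrict (Ioo h T)),
      ENNReal.ofReal (g s - g (s - h) - h * ρ s) ≤ R s h) :
    DistribDerivLE T g ρ := by
  intro ξ hξ hξ_nonneg
  obtain ⟨c, d, hc, -, -, hout⟩ := hξ.exists_Icc hT
  obtain ⟨C, hC⟩ := hξ.compact.exists_bound_of_continuous hξ.smooth.continuous
  set ĝ : ℝ → ℝ := IccExtend hT.le ((Icc 0 T).domRestrict g)
  have hĝ : Continuous ĝ := hg.domRestrict.Icc_extend'
  have hĝ_eq : ∀ s ∈ Icc 0 T, ĝ s = g s := fun s hs => IccExtend_of_mem _ _ hs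
  have hlim : Tendsto (fun h => (∫ s in Ioo 0 T, ρ s * ξ s)
      + C * ((∫⁻ s in Ioo h T, R s h) / ENNReal.ofReal h).toReal)
      (𝓝[>] (0 : ℝ)) (𝓝 (∫ s in Ioo 0 T, ρ s * ξ s)) := by
    simpa only [Function.comp_apply, ENNReal.toReal_zero, mul_zero, add_zero] using
      (((ENNReal.tendsto_toReal ENNReal.zero_ne_top).comp hR.tendsto).const_mul C).const_add
        (∫ s in Ioo 0 T, ρ s * ξ s)
  have hextend : ∫ s in Ioo 0 T, g s * deriv ξ s = ∫ s, ĝ s * deriv ξ s :=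
    calc ∫ s in Ioo 0 T, g s * deriv ξ s = ∫ s in Ioo 0 T, ĝ s * deriv ξ s :=
          setIntegral_congr_fun measurableSet_Ioo fun s hs =>
            congrArg (· * deriv ξ s) (hĝ_eq s (Ioo_subset_Icc_self hs)).symm
      _ = ∫ s, ĝ s * deriv ξ s := setIntegral_eq_integral_of_forall_compl_eq_zero fun s hs => by
          rw [image_eq_zero_of_notMem_tsupport fun hs' =>
            hs (hξ.support (tsupport_deriv_subset hs')), mul_zero]
  rw [hextend]
  refine le_of_tendsto_of_tendsto (tendsto_integral_mul_sub_translate_div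
    (hξ.smooth.of_le (by exact_mod_cast le_top)) hξ.compact hĝ) hlim ?_
  filter_upwards [Ioo_mem_nhdsGT hc, hR.tendsto.eventually (gt_mem_nhds zero_lt_one)] with h hh hlt
  refine integral_mul_sub_translate_div_le hĝ hρ hξ hξ_nonneg
    (fun t => (le_abs_self _).trans (hC t)) hh.1
    (fun t ht => hout t fun hmem => by linarith [hmem.1, hh.2]) (hlt.trans ENNReal.one_lt_top).ne ?_
  filter_upwards [hle h hh.1, ae_restrict_mem measurableSet_Ioo] with s hs hmem
  rwa [hĝ_eq s ⟨(hh.1.trans hmem.1).le, hmem.2.le⟩,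
    hĝ_eq (s - h) ⟨by linarith [hmem.1], by linarith [hmem.2, hh.1]⟩]

theorem DistribDerivLE.of_tendsto {ι : Type*} {l : Filter ι} [l.NeBot] [l.IsCountablyGenerated]
    {g ρ : ι → ℝ → ℝ} {g₀ ρ₀ Cg Cρ : ℝ → ℝ} (h : ∀ᶠ i in l, DistribDerivLE T (g i) (ρ i))
    (hg : ∀ᶠ i in l, IntegrableOn (g i) (Ioo 0 T)) (hρ : ∀ᶠ i in l, IntegrableOn (ρ i) (Ioo 0 T))
    (hg_le : ∀ᶠ i in l, ∀ t, |g i t| ≤ Cg t) (hρ_le : ∀ᶠ i in l, ∀ t, |ρ i t| ≤ Cρ t)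
    (hCg : IntegrableOn Cg (Ioo 0 T)) (hCρ : IntegrableOn Cρ (Ioo 0 T))
    (hg_lim : ∀ t, Tendsto (g · t) l (𝓝 (g₀ t))) (hρ_lim : ∀ t, Tendsto (ρ · t) l (𝓝 (ρ₀ t))) :
    DistribDerivLE T g₀ ρ₀ := by
  intro ξ hξ hξ_nonneg
  have hlim {f : ι → ℝ → ℝ} {f₀ C θ : ℝ → ℝ} (hf : ∀ᶠ i in l, IntegrableOn (f i) (Ioo 0 T))
      (hle : ∀ᶠ i in l, ∀ t, |f i t| ≤ C t) (hf_lim : ∀ t, Tendsto (f · t) l (𝓝 (f₀ t)))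
      (hθ : Continuous θ) (hC : IntegrableOn (fun t => θ t * C t) (Ioo 0 T)) :
      Tendsto (fun i => ∫ t in Ioo 0 T, f i t * θ t) l (𝓝 (∫ t in Ioo 0 T, f₀ t * θ t)) := by
    refine tendsto_integral_filter_of_dominated_convergence _ ?_ ?_ hC.norm
      (ae_of_all _ fun t => (hf_lim t).mul_const (θ t))
    · exact hf.mono fun i hi => hi.1.mul hθ.aestronglyMeasurable
    · refine hle.mono fun i hi => ae_of_all _ fun t => ?_
      rw [norm_mul, norm_mul, mul_comm]
      exact mul_le_mul_of_nonneg_left ((hi t).trans (le_abs_self _)) (norm_nonneg _)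
  exact le_of_tendsto_of_tendsto
    (hlim hg hg_le hg_lim hξ.continuous_deriv (hξ.integrable_mul hCg).2).neg
    (hlim hρ hρ_le hρ_lim hξ.smooth.continuous (hξ.integrable_mul hCρ).1)
    (h.mono fun i hi => hi ξ hξ hξ_nonneg)

end BackwardDifference

/-! ### The Nemytskii operator of the `p`-Laplacian -/

/-- `|y|^{p-2} y`, as a function of the real variable `y`. -/
noncomputable def signedPow (p y : ℝ) : ℝ := |y| ^ (p - 2) * y

@[simp]
theorem signedPow_zero (p : ℝ) : signedPow p 0 = 0 := mul_zero _

theorem signedPow_neg (p y : ℝ) : signedPow p (-y) = -signedPow p y := by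
  simp only [signedPow, abs_neg, mul_neg]

section SignedPow

variable {p : ℝ}

theorem abs_signedPow (hp : 1 < p) (y : ℝ) : |signedPow p y| = |y| ^ (p - 1) := by
  rcases eq_or_ne y 0 with rfl | hy
  · rw [signedPow_zero, abs_zero, Real.zero_rpow (sub_pos.2 hp).ne']
  · rw [signedPow, abs_mul, abs_of_nonneg (Real.rpow_nonneg (abs_nonneg y) _),
      ← Real.rpow_add_one (abs_pos.2 hy).ne']
    ring_nf

theorem signedPow_of_nonneg (hp : 1 < p) {y : ℝ} (hy : 0 ≤ y) : signedPow p y = y ^ (p - 1) := by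
  rw [← abs_of_nonneg (a := signedPow p y) (mul_nonneg (Real.rpow_nonneg (abs_nonneg y) _) hy),
    abs_signedPow hp, abs_of_nonneg hy]

theorem monotone_signedPow (hp : 1 < p) : Monotone (signedPow p) :=
  monotone_of_odd_of_monotoneOn_nonneg (signedPow_neg p) fun x hx y hy hxy => by
    rw [signedPow_of_nonneg hp hx, signedPow_of_nonneg hp hy]
    exact Real.rpow_le_rpow hx hxy (sub_pos.2 hp).le

theorem continuous_signedPow (hp : 1 < p) : Continuous (signedPow p) := by
  have hp' : 0 < p - 1 := sub_pos.2 hp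
  have hparts : signedPow p = fun y => max y 0 ^ (p - 1) - max (-y) 0 ^ (p - 1) := by
    funext y
    rcases le_total 0 y with hy | hy
    · rw [signedPow_of_nonneg hp hy, max_eq_left hy, max_eq_right (neg_nonpos.2 hy),
        Real.zero_rpow hp'.ne', sub_zero]
    · rw [← neg_neg (signedPow p y), ← signedPow_neg, signedPow_of_nonneg hp (neg_nonneg.2 hy),
        max_eq_right hy, max_eq_left (neg_nonneg.2 hy), Real.zero_rpow hp'.ne', zero_sub]
  rw [hparts]
  exact ((continuous_id.max continuous_const).rpow_const fun _ => Or.inr hp'.le).sub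
    ((continuous_id.neg.max continuous_const).rpow_const fun _ => Or.inr hp'.le)

end SignedPow

theorem tendstoInMeasure_comp_continuous {α X Y : Type*} [MeasurableSpace α] {μ : Measure α}
    [IsFiniteMeasure μ] [PseudoEMetricSpace X] [PseudoEMetricSpace Y] {Φ : X → Y}
    (hΦ : Continuous Φ) {g : ℕ → α → X} {g₀ : α → X} (hg_meas : ∀ n, AEStronglyMeasurable (g n) μ)
    (hg : TendstoInMeasure μ g atTop g₀) :
    TendstoInMeasure μ (fun n x => Φ (g n x)) atTop fun x => Φ (g₀ x) :=
  (exists_seq_tendstoInMeasure_atTop_iff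
    fun n => hΦ.comp_aestronglyMeasurable (hg_meas n)).2 fun ns hns => by
      obtain ⟨ms, hms, hlim⟩ := (hg.comp hns.tendsto_atTop).exists_seq_tendsto_ae
      exact ⟨ms, hms, hlim.mono fun x hx => (hΦ.tendsto _).comp hx⟩

section Nemytskii

variable {α : Type*} [MeasurableSpace α] {μ : Measure α} {p q : ℝ≥0∞} [p.HolderConjugate q]

theorem one_lt_toReal_of_holderConjugate (hp : p ≠ ∞) (hq : q ≠ ∞) : 1 < p.toReal :=
  (ENNReal.HolderConjugate.toReal_of_ne_top hp hq).lt

theorem eLpNorm_signedPow (hp : p ≠ ∞) (hq : q ≠ ∞) (g : α → ℝ) :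
    eLpNorm (fun x => signedPow p.toReal (g x)) q μ = eLpNorm g p μ ^ (p.toReal - 1) := by
  have hone := one_lt_toReal_of_holderConjugate (q := q) hp hq
  have hexponent : q * ENNReal.ofReal (p.toReal - 1) = p := by
    rw [← ENNReal.toReal_eq_toReal_iff' (ENNReal.mul_ne_top hq ENNReal.ofReal_ne_top) hp,
      ENNReal.toReal_mul, ENNReal.toReal_ofReal (sub_pos.2 hone).le, mul_comm]
    exact (ENNReal.HolderConjugate.toReal_of_ne_top hp hq).sub_one_mul_conj
  rw [eLpNorm_congr_norm_ae (g := fun x => ‖g x‖ ^ (p.toReal - 1)) (ae_of_all _ fun x => by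
      rw [Real.norm_eq_abs, abs_signedPow hone, Real.norm_eq_abs, Real.norm_eq_abs,
        abs_of_nonneg (Real.rpow_nonneg (abs_nonneg _) _)]),
    eLpNorm_norm_rpow g (sub_pos.2 hone), hexponent]

theorem memLp_signedPow (hp : p ≠ ∞) (hq : q ≠ ∞) {g : α → ℝ} (hg : MemLp g p μ) :
    MemLp (fun x => signedPow p.toReal (g x)) q μ := by
  have hone := one_lt_toReal_of_holderConjugate (q := q) hp hq
  refine ⟨(continuous_signedPow hone).comp_aestronglyMeasurable hg.1, ?_⟩
  rw [eLpNorm_signedPow hp hq]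
  exact ENNReal.rpow_lt_top_of_nonneg (sub_pos.2 hone).le hg.2.ne

theorem unifIntegrable_signedPow {ι : Type*} (hp : p ≠ ∞) (hq : q ≠ ∞) {g : ι → α → ℝ}
    (hg : UnifIntegrable g p μ) :
    UnifIntegrable (fun i x => signedPow p.toReal (g i x)) q μ := by
  have hpos : 0 < p.toReal - 1 := sub_pos.2 (one_lt_toReal_of_holderConjugate (q := q) hp hq)
  intro ε hε
  obtain ⟨δ, hδ, hsmall⟩ := hg (Real.rpow_pos_of_pos hε (p.toReal - 1)⁻¹)
  refine ⟨δ, hδ, fun i s hs hμs => ?_⟩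
  have hindicator : (s.indicator fun x => signedPow p.toReal (g i x))
      = fun x => signedPow p.toReal (s.indicator (g i) x) :=
    indicator_comp_of_zero (signedPow_zero _)
  rw [hindicator, eLpNorm_signedPow hp hq]
  refine (ENNReal.rpow_le_rpow (hsmall i s hs hμs) hpos.le).trans_eq ?_
  rw [ENNReal.ofReal_rpow_of_nonneg (Real.rpow_nonneg hε.le _) hpos.le,
    Real.rpow_inv_rpow hε.le hpos.ne']

/-- The Nemytskii operator `g ↦ |g|^{p-2} g` from `Lᵖ` to its dual space. -/
noncomputable def nemytskii (hp : p ≠ ∞) (hq : q ≠ ∞) (g : Lp ℝ p μ) : Lp ℝ q μ :=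
  (memLp_signedPow hp hq (Lp.memLp g)).toLp _

theorem coeFn_nemytskii (hp : p ≠ ∞) (hq : q ≠ ∞) (g : Lp ℝ p μ) :
    nemytskii hp hq g =ᵐ[μ] fun x => signedPow p.toReal (g x) :=
  MemLp.coeFn_toLp _

theorem enorm_nemytskii (hp : p ≠ ∞) (hq : q ≠ ∞) (g : Lp ℝ p μ) :
    ‖nemytskii hp hq g‖ₑ = ‖g‖ₑ ^ (p.toReal - 1) := by
  rw [nemytskii, Lp.enorm_toLp, eLpNorm_signedPow hp hq, Lp.enorm_def]

theorem continuous_nemytskii [IsFiniteMeasure μ] [Fact (1 ≤ p)] [Fact (1 ≤ q)] (hp : p ≠ ∞)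
    (hq : q ≠ ∞) : Continuous (nemytskii (μ := μ) hp hq) := by
  refine SeqContinuous.continuous fun g g₀ hg => ?_
  have hmem : ∀ f : Lp ℝ p μ, MemLp (fun x => signedPow p.toReal (f x)) q μ := fun f =>
    memLp_signedPow hp hq (Lp.memLp f)
  refine (Lp.tendsto_Lp_iff_tendsto_eLpNorm'' _ (fun n => hmem (g n)) _ (hmem g₀)).2 ?_
  refine tendsto_Lp_finite_of_tendstoInMeasure Fact.out hq (fun n => (hmem (g n)).1) (hmem g₀)
    (unifIntegrable_signedPow hp hq (unifIntegrable_of_tendsto_Lp Fact.out hp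
      (fun n => Lp.memLp (g n)) (Lp.memLp g₀) ((Lp.tendsto_Lp_iff_tendsto_eLpNorm' _ _).1 hg)))
    (tendstoInMeasure_comp_continuous
      (continuous_signedPow (one_lt_toReal_of_holderConjugate (q := q) hp hq))
      (fun n => Lp.aestronglyMeasurable (g n)) (tendstoInMeasure_of_tendsto_Lp hg))

theorem memLp_nemytskii [IsFiniteMeasure μ] [Fact (1 ≤ p)] [Fact (1 ≤ q)] {Ω : Type*}
    [MeasurableSpace Ω] {ν : Measure Ω} (hp : p ≠ ∞) (hq : q ≠ ∞) {g : Ω → Lp ℝ p μ}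
    (hg : MemLp g p ν) : MemLp (fun t => nemytskii hp hq (g t)) q ν :=
  (memLp_signedPow hp hq hg.norm).congr_enorm
    ((continuous_nemytskii hp hq).comp_aestronglyMeasurable hg.1) (ae_of_all _ fun t => by
      have hone := one_lt_toReal_of_holderConjugate (q := q) hp hq
      rw [enorm_nemytskii, signedPow_of_nonneg hone (norm_nonneg _),
        Real.enorm_of_nonneg (Real.rpow_nonneg (norm_nonneg _) _),
        ← ENNReal.ofReal_rpow_of_nonneg (norm_nonneg _) (sub_pos.2 hone).le, ofReal_norm])

end Nemytskii

/-! ### Smooth approximations of the sign function and of the distance -/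

/-- A nondecreasing function of class `C¹` with values in `[-1, 1]` and Lipschitz constant `K`,
used as a regularization of the sign function. -/
structure IsSmoothedSign (S : ℝ → ℝ) (K : NNReal) : Prop where
  contDiff : ContDiff ℝ 1 S
  monotone : Monotone S
  lipschitz : LipschitzWith K S
  abs_le_one : ∀ y, |S y| ≤ 1

/-- `(2 / π) arctan (n y)`, which tends to the sign of `y` as `n → ∞`. -/
noncomputable def smoothSign (n : ℕ) (y : ℝ) : ℝ := 2 / Real.pi * Real.arctan (n * y)

theorem hasDerivAt_smoothSign (n : ℕ) (y : ℝ) :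
    HasDerivAt (smoothSign n) (2 / Real.pi * (n / (1 + (n * y) ^ 2))) y := by
  refine ((((hasDerivAt_id y).const_mul (n : ℝ)).arctan).const_mul (2 / Real.pi)).congr_deriv ?_
  simp only [id]
  ring

theorem lipschitzWith_smoothSign (n : ℕ) : LipschitzWith n (smoothSign n) := by
  refine lipschitzWith_of_nnnorm_deriv_le
    (fun y => (hasDerivAt_smoothSign n y).differentiableAt) fun y => ?_
  rw [← NNReal.coe_le_coe, coe_nnnorm, (hasDerivAt_smoothSign n y).deriv, NNReal.coe_natCast,
    Real.norm_of_nonneg (by positivity)]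
  calc 2 / Real.pi * (n / (1 + (n * y) ^ 2)) ≤ 1 * n :=
        mul_le_mul ((div_le_one Real.pi_pos).2 Real.two_le_pi)
          (div_le_self n.cast_nonneg (le_add_of_nonneg_right (sq_nonneg _))) (by positivity)
          zero_le_one
    _ = n := one_mul _

theorem abs_smoothSign_le_one (n : ℕ) (y : ℝ) : |smoothSign n y| ≤ 1 := by
  have harctan : |Real.arctan (n * y)| ≤ Real.pi / 2 :=
    abs_le.2 ⟨(Real.neg_pi_div_two_lt_arctan _).le, (Real.arctan_lt_pi_div_two _).le⟩
  rw [smoothSign, abs_mul, abs_of_pos (by positivity)]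
  calc 2 / Real.pi * |Real.arctan (n * y)| ≤ 2 / Real.pi * (Real.pi / 2) := by gcongr
    _ = 1 := by field_simp

theorem isSmoothedSign_smoothSign (n : ℕ) : IsSmoothedSign (smoothSign n) n where
  contDiff := contDiff_const.mul (contDiff_const.mul contDiff_id).arctan
  monotone _ _ hxy := mul_le_mul_of_nonneg_left
    (Real.arctan_strictMono.monotone (mul_le_mul_of_nonneg_left hxy n.cast_nonneg)) (by positivity)
  lipschitz := lipschitzWith_smoothSign n
  abs_le_one := abs_smoothSign_le_one n

theorem tendsto_smoothSign_of_pos {y : ℝ} (hy : 0 < y) :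
    Tendsto (fun n => smoothSign n y) atTop (𝓝 1) := by
  have hatTop : Tendsto (fun n : ℕ => (n : ℝ) * y) atTop atTop :=
    tendsto_natCast_atTop_atTop.atTop_mul_const hy
  have hlim : 2 / Real.pi * (Real.pi / 2) = 1 := by field_simp
  exact hlim ▸ ((tendsto_nhdsWithin_iff.1 Real.tendsto_arctan_atTop).1.comp hatTop).const_mul _

theorem tendsto_smoothSign_of_neg {y : ℝ} (hy : y < 0) :
    Tendsto (fun n => smoothSign n y) atTop (𝓝 (-1)) :=
  (tendsto_smoothSign_of_pos (neg_pos.2 hy)).neg.congr fun n => by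
    rw [smoothSign, smoothSign, mul_neg, Real.arctan_neg, mul_neg, neg_neg]

/-- The convex function `r ↦ ∫_{o a}^r S (o⁻¹ ρ - a) dρ`, which approximates `r ↦ |r - o a|` when
`S` approximates the sign function. -/
noncomputable def entropy (S : ℝ → ℝ) (o : ℝ ≃o ℝ) (a r : ℝ) : ℝ :=
  ∫ ρ in o a..r, S (o.symm ρ - a)

theorem entropy_self (S : ℝ → ℝ) (o : ℝ ≃o ℝ) (a : ℝ) : entropy S o a (o a) = 0 :=
  intervalIntegral.integral_same

namespace IsSmoothedSign

variable {S : ℝ → ℝ} {K : NNReal} (hS : IsSmoothedSign S K) (o : ℝ ≃o ℝ)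
include hS

theorem continuous : Continuous S := hS.contDiff.continuous

theorem norm_deriv_le (y : ℝ) : ‖deriv S y‖ ≤ K := norm_deriv_le_of_lipschitz hS.lipschitz

theorem intervalIntegrable_comp_symm (a r r' : ℝ) :
    IntervalIntegrable (fun ρ => S (o.symm ρ - a)) volume r r' :=
  (hS.continuous.comp (o.symm.continuous.sub continuous_const)).intervalIntegrable _ _

theorem entropy_sub (a r r' : ℝ) :
    entropy S o a r' - entropy S o a r = ∫ ρ in r..r', S (o.symm ρ - a) :=
  intervalIntegral.integral_interval_sub_left (hS.intervalIntegrable_comp_symm o a _ _)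
    (hS.intervalIntegrable_comp_symm o a _ _)

theorem continuous_entropy : Continuous fun x : ℝ × ℝ => entropy S o x.1 x.2 := by
  have hprimitive : ∀ b : ℝ × ℝ → ℝ, Continuous b →
      Continuous fun x : ℝ × ℝ => ∫ ρ in (0 : ℝ)..b x, S (o.symm ρ - x.1) := fun b hb =>
    intervalIntegral.continuous_parametric_intervalIntegral_of_continuous
      (f := fun (x : ℝ × ℝ) ρ => S (o.symm ρ - x.1)) (hS.continuous.comp
        ((o.symm.continuous.comp continuous_snd).sub (continuous_fst.comp continuous_fst))) hb
  exact ((hprimitive _ continuous_snd).sub (hprimitive _ (o.continuous.comp continuous_fst))).congr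
    fun x => intervalIntegral.integral_interval_sub_left
      (hS.intervalIntegrable_comp_symm o _ _ _) (hS.intervalIntegrable_comp_symm o _ _ _)

theorem abs_entropy_sub_le (a r r' : ℝ) :
    |entropy S o a r' - entropy S o a r| ≤ |r' - r| := by
  rw [hS.entropy_sub, ← one_mul |r' - r|]
  exact intervalIntegral.norm_integral_le_of_norm_le_const (f := fun ρ => S (o.symm ρ - a)) (C := 1)
    fun ρ _ => hS.abs_le_one _

theorem abs_entropy_le (a r : ℝ) : |entropy S o a r| ≤ |r - o a| := by
  simpa only [entropy_self, sub_zero] using hS.abs_entropy_sub_le o a (o a) r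

theorem mul_sub_le_entropy_sub (a r r' : ℝ) :
    S (o.symm r - a) * (r' - r) ≤ entropy S o a r' - entropy S o a r := by
  have hmono : Monotone fun ρ => S (o.symm ρ - a) := fun x y hxy =>
    hS.monotone (sub_le_sub_right (o.symm.monotone hxy) a)
  have hconst : ∀ x y : ℝ, ∫ _ in x..y, S (o.symm r - a) = S (o.symm r - a) * (y - x) :=
    fun x y => by rw [intervalIntegral.integral_const, smul_eq_mul, mul_comm]
  rw [hS.entropy_sub]
  rcases le_total r r' with hle | hle
  · rw [← hconst]
    exact intervalIntegral.integral_mono_on hle intervalIntegrable_const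
      (hS.intervalIntegrable_comp_symm o a _ _) fun x hx => hmono hx.1
  · have hreverse := intervalIntegral.integral_mono_on hle
      (hS.intervalIntegrable_comp_symm o a _ _) intervalIntegrable_const fun x hx => hmono hx.2
    rw [hconst] at hreverse
    rw [intervalIntegral.integral_symm]
    linarith

section Integral

variable {α : Type*} [MeasurableSpace α] {μ : Measure α} {a v v' : α → ℝ}

theorem integrable_entropy (ha : AEStronglyMeasurable a μ) (hoa : Integrable (fun x => o (a x)) μ)
    (hv : Integrable v μ) : Integrable (fun x => entropy S o (a x) (v x)) μ :=
  (hv.sub hoa).mono ((hS.continuous_entropy o).comp_aestronglyMeasurable (ha.prodMk hv.1))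
    (ae_of_all _ fun _ => hS.abs_entropy_le o _ _)

theorem abs_integral_entropy_sub_le (ha : AEStronglyMeasurable a μ)
    (hoa : Integrable (fun x => o (a x)) μ) (hv : Integrable v μ) (hv' : Integrable v' μ) :
    |∫ x, entropy S o (a x) (v' x) ∂μ - ∫ x, entropy S o (a x) (v x) ∂μ|
      ≤ ∫ x, |v' x - v x| ∂μ := by
  rw [← integral_sub (hS.integrable_entropy o ha hoa hv') (hS.integrable_entropy o ha hoa hv)]
  exact norm_integral_le_of_norm_le
    (f := fun x => entropy S o (a x) (v' x) - entropy S o (a x) (v x)) (hv'.sub hv).abs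
    (ae_of_all _ fun x => hS.abs_entropy_sub_le o _ _ _)

theorem integral_mul_sub_le_integral_entropy_sub (ha : AEStronglyMeasurable a μ)
    (hoa : Integrable (fun x => o (a x)) μ) (hv : Integrable v μ) (hv' : Integrable v' μ) :
    ∫ x, S (o.symm (v x) - a x) * (v' x - v x) ∂μ
      ≤ ∫ x, entropy S o (a x) (v' x) ∂μ - ∫ x, entropy S o (a x) (v x) ∂μ := by
  have hint := hS.integrable_entropy o ha hoa hv
  have hint' := hS.integrable_entropy o ha hoa hv'
  rw [← integral_sub hint' hint]
  refine integral_mono ((hv'.sub hv).bdd_mul (c := 1) ?_ (ae_of_all _ fun _ => hS.abs_le_one _))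
    (hint'.sub hint) fun x => hS.mul_sub_le_entropy_sub o _ _ _
  exact hS.continuous.comp_aestronglyMeasurable
    ((o.symm.continuous.comp_aestronglyMeasurable hv.1).sub ha)

end Integral

end IsSmoothedSign

theorem tendsto_entropy_smoothSign (o : ℝ ≃o ℝ) (a r : ℝ) :
    Tendsto (fun n => entropy (smoothSign n) o a r) atTop (𝓝 |r - o a|) := by
  have hdominated : ∀ c : ℝ, (∀ᵐ ρ, ρ ∈ uIoc (o a) r →
      Tendsto (fun n => smoothSign n (o.symm ρ - a)) atTop (𝓝 c)) →
      Tendsto (fun n => entropy (smoothSign n) o a r) atTop (𝓝 (∫ _ in o a..r, c)) := fun c hc =>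
    intervalIntegral.tendsto_integral_filter_of_dominated_convergence (fun _ => 1)
      (Eventually.of_forall fun n => ((isSmoothedSign_smoothSign n).continuous.comp
        (o.symm.continuous.sub continuous_const)).aestronglyMeasurable)
      (Eventually.of_forall fun n => ae_of_all _ fun ρ _ => abs_smoothSign_le_one n _)
      intervalIntegrable_const hc
  rcases le_total (o a) r with hle | hle
  · have hlim := hdominated 1 (ae_of_all _ fun ρ hρ => by
      rw [uIoc_of_le hle] at hρ
      exact tendsto_smoothSign_of_pos (sub_pos.2 (o.lt_symm_apply.2 hρ.1)))
    rwa [intervalIntegral.integral_const, smul_eq_mul, mul_one,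
      ← abs_of_nonneg (sub_nonneg.2 hle)] at hlim
  · have hlim := hdominated (-1) (by
      filter_upwards [compl_mem_ae_iff.2 (measure_singleton (o a))] with ρ hne hρ
      rw [uIoc_of_ge hle] at hρ
      exact tendsto_smoothSign_of_neg
        (sub_neg.2 (o.symm_apply_lt.2 (lt_of_le_of_ne hρ.2 hne))))
    rwa [intervalIntegral.integral_const, smul_eq_mul, mul_neg_one,
      ← abs_of_nonpos (sub_nonpos.2 hle)] at hlim

theorem tendsto_integral_entropy_smoothSign {α : Type*} [MeasurableSpace α] {μ : Measure α}
    (o : ℝ ≃o ℝ) {a v : α → ℝ} (ha : AEStronglyMeasurable a μ)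
    (hoa : Integrable (fun x => o (a x)) μ) (hv : Integrable v μ) :
    Tendsto (fun n => ∫ x, entropy (smoothSign n) o (a x) (v x) ∂μ) atTop
      (𝓝 (∫ x, |v x - o (a x)| ∂μ)) :=
  tendsto_integral_of_dominated_convergence (fun x => |v x - o (a x)|)
    (fun n => ((isSmoothedSign_smoothSign n).integrable_entropy o ha hoa hv).1) (hv.sub hoa).abs
    (fun n => ae_of_all _ fun _ => (isSmoothedSign_smoothSign n).abs_entropy_le o _ _)
    (ae_of_all _ fun _ => tendsto_entropy_smoothSign o _ _)

/-! ### Functions of class `𝒲^{1,q}` on a graph -/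

namespace CompactMetricGraph

variable {V E : Type*} [Fintype V] [Fintype E] {G : CompactMetricGraph V E}

/-- Every vertex is an end of some edge, so that the vertex values of a function of class
`𝒲^{1,q}` are determined by its values on the edges. -/
def NoIsolatedVertex (G : CompactMetricGraph V E) : Prop :=
  ∀ a, ∃ e, G.init e = a ∨ G.term e = a

theorem Connected.noIsolatedVertex [Nonempty E] (hG : G.Connected) : G.NoIsolatedVertex := by
  intro a
  obtain ⟨e₀⟩ := ‹Nonempty E›
  have : Nontrivial V := ⟨_, _, G.no_loop e₀⟩
  obtain ⟨b, hb⟩ := SimpleGraph.Preconnected.exists_adj_of_nontrivial hG.preconnected a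
  rw [SimpleGraph.fromRel_adj] at hb
  rcases hb.2 with ⟨e, h, -⟩ | ⟨e, -, h⟩
  · exact ⟨e, Or.inl h⟩
  · exact ⟨e, Or.inr h⟩

section Sobolev

variable {q r : E → ℝ≥0∞}

/-- The pair of functions with the given components. -/
noncomputable def PairSpace.mk (f g : E → ℝ → ℝ) (hf : ∀ e, MemLp (f e) (q e) (G.edgeMeasure e))
    (hg : ∀ e, MemLp (g e) (q e) (G.edgeMeasure e)) : G.PairSpace q :=
  WithLp.toLp 1 fun e => WithLp.toLp (q e) ((hf e).toLp _, (hg e).toLp _)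

theorem PairSpace.fn_mk (f g : E → ℝ → ℝ) (hf : ∀ e, MemLp (f e) (q e) (G.edgeMeasure e))
    (hg : ∀ e, MemLp (g e) (q e) (G.edgeMeasure e)) (e : E) :
    (PairSpace.mk f g hf hg).fn e =ᵐ[G.edgeMeasure e] f e :=
  (hf e).coeFn_toLp

theorem PairSpace.der_mk (f g : E → ℝ → ℝ) (hf : ∀ e, MemLp (f e) (q e) (G.edgeMeasure e))
    (hg : ∀ e, MemLp (g e) (q e) (G.edgeMeasure e)) (e : E) :
    (PairSpace.mk f g hf hg).der e =ᵐ[G.edgeMeasure e] g e :=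
  (hg e).coeFn_toLp

theorem HasVertexValues.comp {u : G.PairSpace q} {c : V → ℝ} (hu : HasVertexValues u c)
    {S : ℝ → ℝ} (hS : Continuous S) {w : G.PairSpace r}
    (hw : ∀ e, w.fn e =ᵐ[G.edgeMeasure e] fun x => S (u.fn e x)) :
    HasVertexValues w fun a => S (c a) := by
  intro e
  obtain ⟨f, hf, huf, hf_init, hf_term⟩ := hu e
  refine ⟨fun x => S (f x), hS.comp_continuousOn hf, (hw e).trans (huf.fun_comp S),
    congrArg S hf_init, congrArg S hf_term⟩

variable [∀ e, Fact (1 ≤ q e)]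

namespace Sobolev

theorem aestronglyMeasurable_fn (u : G.Sobolev q) (e : E) :
    AEStronglyMeasurable (fn u e) (G.edgeMeasure e) :=
  Lp.aestronglyMeasurable _

theorem memLp_der (u : G.Sobolev q) (e : E) : MemLp (der u e) (q e) (G.edgeMeasure e) :=
  Lp.memLp _

theorem fn_sub (u w : G.Sobolev q) (e : E) :
    fn (u - w) e =ᵐ[G.edgeMeasure e] fun x => fn u e x - fn w e x :=
  Lp.coeFn_sub ((u : G.PairSpace q) e).fst ((w : G.PairSpace q) e).fst

theorem der_sub (u w : G.Sobolev q) (e : E) :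
    der (u - w) e =ᵐ[G.edgeMeasure e] fun x => der u e x - der w e x :=
  Lp.coeFn_sub ((u : G.PairSpace q) e).snd ((w : G.PairSpace q) e).snd

theorem fn_smul (c : ℝ) (u : G.Sobolev q) (e : E) :
    fn (c • u) e =ᵐ[G.edgeMeasure e] fun x => c * fn u e x :=
  PairSpace.fn_smul c (u : G.PairSpace q) e

theorem der_smul (c : ℝ) (u : G.Sobolev q) (e : E) :
    der (c • u) e =ᵐ[G.edgeMeasure e] fun x => c * der u e x :=
  PairSpace.der_smul c (u : G.PairSpace q) e

theorem memLp_comp_fn (u : G.Sobolev q) {S : ℝ → ℝ} (hS : Continuous S) (e : E) (s : ℝ≥0∞) :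
    MemLp (fun x => S (fn u e x)) s (G.edgeMeasure e) := by
  obtain ⟨f, hf, huf, -⟩ := hasVertexValues u e
  obtain ⟨C, hC⟩ := isCompact_Icc.exists_bound_of_continuousOn (hS.comp_continuousOn hf)
  refine MemLp.of_bound (hS.comp_aestronglyMeasurable (aestronglyMeasurable_fn u e)) C ?_
  filter_upwards [huf, ae_restrict_mem measurableSet_Ioo] with x hx hx_mem
  exact (congrArg (‖S ·‖) hx).trans_le (hC x (Ioo_subset_Icc_self hx_mem))

theorem vertexValue_eq (hG : G.NoIsolatedVertex) {u : G.Sobolev q} {c : V → ℝ}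
    (hc : HasVertexValues (u : G.PairSpace q) c) (a : V) : vertexValue u a = c a := by
  obtain ⟨e, rfl | rfl⟩ := hG a
  · exact (vertexValue_unique u hc e).1
  · exact (vertexValue_unique u hc e).2

theorem vertexValue_smul (hG : G.NoIsolatedVertex) (c : ℝ) (u : G.Sobolev q) (a : V) :
    vertexValue (c • u) a = c * vertexValue u a :=
  vertexValue_eq hG ((hasVertexValues u).comp (continuous_const_mul c) (fn_smul c u)) a

section Composition

variable {S : ℝ → ℝ} {K : NNReal}

theorem hasWeakDeriv_comp (hS : ContDiff ℝ 1 S) (hK : LipschitzWith K S) (u : G.Sobolev q)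
    (e : E) : HasWeakDeriv 0 (G.length e) (fun x => S (fn u e x))
      fun x => deriv S (fn u e x) * der u e x := by
  obtain ⟨c, hc⟩ := (u.2.1 e).exists_eq_const_add_integral (G.length_pos e)
    (PairSpace.integrable_fn _ e) (PairSpace.integrable_der _ e)
  refine (hasWeakDeriv_comp_const_add_integral (G.length_pos e).le
    (PairSpace.integrable_der (u : G.PairSpace q) e) c hK
    (hS.differentiable one_ne_zero)).congr (hc.symm.fun_comp S) ?_
  filter_upwards [hc] with x hx
  exact congrArg (fun y => deriv S y * der u e x) hx.symm

theorem memLp_deriv_comp_mul_der (hS : ContDiff ℝ 1 S) (hK : LipschitzWith K S) (u : G.Sobolev q)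
    (e : E) : MemLp (fun x => deriv S (fn u e x) * der u e x) (q e) (G.edgeMeasure e) := by
  refine MemLp.of_le_mul (c := K) (memLp_der u e) ?_ (ae_of_all _ fun x => ?_)
  · exact ((hS.continuous_deriv le_rfl).comp_aestronglyMeasurable
      (aestronglyMeasurable_fn u e)).mul (memLp_der u e).1
  · rw [norm_mul]
    exact mul_le_mul_of_nonneg_right (norm_deriv_le_of_lipschitz hK) (norm_nonneg _)

/-- The composition `S ∘ u` of a function of class `𝒲^{1,q}` with a Lipschitz function `S` of class
`C¹`. -/
noncomputable def comp (hS : ContDiff ℝ 1 S) (hK : LipschitzWith K S) (u : G.Sobolev q) :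
    G.Sobolev q :=
  have hfn := fun e => memLp_comp_fn u hS.continuous e (q e)
  have hder := memLp_deriv_comp_mul_der hS hK u
  ⟨PairSpace.mk _ _ hfn hder,
    fun e => (hasWeakDeriv_comp hS hK u e).congr (PairSpace.fn_mk _ _ hfn hder e).symm
      (PairSpace.der_mk _ _ hfn hder e).symm,
    _, (hasVertexValues u).comp hS.continuous (PairSpace.fn_mk _ _ hfn hder)⟩

variable (hS : ContDiff ℝ 1 S) (hK : LipschitzWith K S) (u : G.Sobolev q)

theorem fn_comp (e : E) : fn (comp hS hK u) e =ᵐ[G.edgeMeasure e] fun x => S (fn u e x) :=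
  PairSpace.fn_mk _ _ _ _ e

theorem der_comp (e : E) :
    der (comp hS hK u) e =ᵐ[G.edgeMeasure e] fun x => deriv S (fn u e x) * der u e x :=
  PairSpace.der_mk _ _ _ _ e

theorem vertexValue_comp (hG : G.NoIsolatedVertex) (a : V) :
    vertexValue (comp hS hK u) a = S (vertexValue u a) :=
  vertexValue_eq hG ((hasVertexValues u).comp hS.continuous (fn_comp hS hK u)) a

end Composition

/-- The inclusion of `𝒲^{1,q}(G)` in `𝒲^{1,1}(G)`. -/
noncomputable def toOne (u : G.Sobolev q) : G.SobolevOne :=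
  have hfn := fun e => memLp_one_iff_integrable.2 (PairSpace.integrable_fn (u : G.PairSpace q) e)
  have hder := fun e => memLp_one_iff_integrable.2 (PairSpace.integrable_der (u : G.PairSpace q) e)
  ⟨PairSpace.mk _ _ hfn hder,
    fun e => (u.2.1 e).congr (PairSpace.fn_mk _ _ hfn hder e).symm
      (PairSpace.der_mk _ _ hfn hder e).symm,
    _, (hasVertexValues u).comp continuous_id (PairSpace.fn_mk _ _ hfn hder)⟩

theorem fn_toOne (u : G.Sobolev q) (e : E) : fn (toOne u) e =ᵐ[G.edgeMeasure e] fn u e :=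
  PairSpace.fn_mk _ _ _ _ e

theorem vertexValue_toOne (hG : G.NoIsolatedVertex) (u : G.Sobolev q) (a : V) :
    vertexValue (toOne u) a = vertexValue u a :=
  vertexValue_eq hG ((hasVertexValues u).comp continuous_id (fn_toOne u)) a

end Sobolev

end Sobolev

end CompactMetricGraph

/-! ### Loads and fluxes -/

namespace CompactMetricGraph

variable {V E : Type*} [Fintype V] [Fintype E] {G : CompactMetricGraph V E}

section Load

variable {q : E → ℝ≥0∞} [∀ e, Fact (1 ≤ q e)]

/-- `∫_G v φ dx`, as a continuous linear form in `v ∈ L¹(G)`. -/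
noncomputable def pairingCLM (φ : G.Sobolev q) : G.L1 →L[ℝ] ℝ :=
  ∑ e, (((ContinuousLinearMap.mul ℝ ℝ).lpPairing (G.edgeMeasure e) 1 ∞).flip
    (Sobolev.memLp_comp_fn φ continuous_id e ∞).toLp).comp (PiLp.proj 1 _ e)

theorem pairingCLM_apply (φ : G.Sobolev q) (v : G.L1) : pairingCLM φ v = G.pairing v φ := by
  simp only [pairingCLM, sum_apply, pairing]
  refine Finset.sum_congr rfl fun e _ => ?_
  change ContinuousLinearMap.lpPairing _ _ _ _ (v e) _ = _
  rw [ContinuousLinearMap.lpPairing_eq_integral]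
  refine integral_congr_ae ?_
  filter_upwards [(Sobolev.memLp_comp_fn φ continuous_id e ∞).coeFn_toLp] with x hx
  rw [hx]
  rfl

theorem abs_pairing_le {φ : G.Sobolev q}
    (hφ : ∀ e, ∀ᵐ x ∂(G.edgeMeasure e), |Sobolev.fn φ e x| ≤ 1) (v : G.L1) :
    |G.pairing v φ| ≤ ‖v‖ := by
  rw [PiLp.norm_eq_of_L1]
  refine (Finset.abs_sum_le_sum_abs _ _).trans (Finset.sum_le_sum fun e _ => ?_)
  rw [L1.norm_eq_integral_norm, ← Real.norm_eq_abs]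
  refine norm_integral_le_of_norm_le (L1.integrable_coeFn (v e)).norm ?_
  filter_upwards [hφ e] with x hx
  rw [norm_mul]
  exact mul_le_of_le_one_right (norm_nonneg _) hx

/-- `∫_G v φ dx + ∑ₐ wₐ φ(a)`, as a continuous linear form in `(v, w) ∈ X`. -/
noncomputable def load (φ : G.Sobolev q) : G.StateSpace →L[ℝ] ℝ :=
  (pairingCLM φ).comp (WithLp.fstL 1 ℝ G.L1 G.VertexL1) +
    (∑ a, Sobolev.vertexValue φ a • PiLp.proj 1 (fun _ : V => ℝ) a).comp
      (WithLp.sndL 1 ℝ G.L1 G.VertexL1)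

theorem load_apply (φ : G.Sobolev q) (y : G.StateSpace) :
    load φ y = G.pairing y.fst φ + ∑ a, y.snd a * Sobolev.vertexValue φ a := by
  simp [load, pairingCLM_apply, mul_comm]

theorem abs_sum_mul_vertexValue_le {φ : G.Sobolev q} (hφ : ∀ a, |Sobolev.vertexValue φ a| ≤ 1)
    (ω : G.VertexL1) : |∑ a, ω a * Sobolev.vertexValue φ a| ≤ ‖ω‖ := by
  rw [PiLp.norm_eq_of_L1]
  refine (Finset.abs_sum_le_sum_abs _ _).trans (Finset.sum_le_sum fun a _ => ?_)
  rw [abs_mul]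
  exact mul_le_of_le_one_right (abs_nonneg _) (hφ a)

theorem abs_load_le {φ : G.Sobolev q}
    (hφ : ∀ e, ∀ᵐ x ∂(G.edgeMeasure e), |Sobolev.fn φ e x| ≤ 1)
    (hφ_vertex : ∀ a, |Sobolev.vertexValue φ a| ≤ 1) (y : G.StateSpace) : |load φ y| ≤ ‖y‖ := by
  rw [load_apply, WithLp.prod_norm_eq_of_L1]
  exact (abs_add_le _ _).trans
    (add_le_add (abs_pairing_le hφ _) (abs_sum_mul_vertexValue_le hφ_vertex _))

theorem pairing_congr {r : E → ℝ≥0∞} [∀ e, Fact (1 ≤ r e)] (v : G.L1) {φ : G.Sobolev q}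
    {ψ : G.Sobolev r} (h : ∀ e, Sobolev.fn ψ e =ᵐ[G.edgeMeasure e] Sobolev.fn φ e) :
    G.pairing v ψ = G.pairing v φ :=
  Finset.sum_congr rfl fun e _ => integral_congr_ae ((EventuallyEq.refl _ (v e)).mul (h e))

theorem pairing_smul_right (v : G.L1) (c : ℝ) (φ : G.Sobolev q) :
    G.pairing v (c • φ) = c * G.pairing v φ := by
  simp only [pairing, Finset.mul_sum, ← integral_const_mul]
  refine Finset.sum_congr rfl fun e _ => integral_congr_ae ?_
  filter_upwards [Sobolev.fn_smul c φ e] with x hx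
  rw [hx]
  ring

end Load

section Flux

instance fact_one_le_conjExponent (p : ℝ≥0∞) : Fact (1 ≤ p.conjExponent) := ⟨le_self_add⟩

theorem conjExponent_ne_top {p : ℝ≥0∞} (hp : 1 < p) : p.conjExponent ≠ ∞ := by
  have := Fact.mk hp.le
  exact fun h => hp.ne' ((ENNReal.HolderConjugate.eq_top_iff_eq_one p.conjExponent p).1 h)

variable {p : E → ℝ≥0∞} [∀ e, Fact (1 ≤ p e)]

theorem MemLpTime.memLp_snd {T : ℝ} {u : ℝ → G.Sobolev p} (hu : G.MemLpTime T u) (e : E) :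
    MemLp (fun t => ((u t : G.PairSpace p) e).snd) (p e) (volume.restrict (Ioo 0 T)) :=
  (hu.2 e).of_le (WithLp.continuous_snd _ _ _ |>.comp_aestronglyMeasurable (hu.2 e).1)
    (ae_of_all _ fun _ => WithLp.norm_snd_le _ _)

variable (hp : ∀ e, 1 < p e) (hp_top : ∀ e, p e < ∞)

/-- `|[u]ₑ'|^{pₑ-2} [u]ₑ'`, as an element of the dual space of `L^{pₑ}(0, ℓₑ)`. -/
noncomputable def flux (u : G.Sobolev p) (e : E) :
    Lp ℝ (p e).conjExponent (G.edgeMeasure e) :=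
  nemytskii (hp_top e).ne (conjExponent_ne_top (hp e)) ((u : G.PairSpace p) e).snd

theorem coeFn_flux (u : G.Sobolev p) (e : E) :
    flux hp hp_top u e =ᵐ[G.edgeMeasure e]
      fun x => signedPow (p e).toReal (Sobolev.der u e x) :=
  coeFn_nemytskii _ _ _

theorem memLp_flux {T : ℝ} {u : ℝ → G.Sobolev p} (hu : G.MemLpTime T u) (e : E) :
    MemLp (fun t => flux hp hp_top (u t) e) (p e).conjExponent (volume.restrict (Ioo 0 T)) :=
  memLp_nemytskii _ _ (hu.memLp_snd e)

/-- `∫₀^{ℓₑ} F [φ]ₑ' dx`, as a continuous linear form in `F`. -/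
noncomputable def derPairing (φ : G.Sobolev p) (e : E) :
    Lp ℝ (p e).conjExponent (G.edgeMeasure e) →L[ℝ] ℝ :=
  (ContinuousLinearMap.mul ℝ ℝ).lpPairing (G.edgeMeasure e) (p e) (p e).conjExponent
    ((φ : G.PairSpace p) e).snd

theorem derPairing_apply (φ : G.Sobolev p) (e : E)
    (F : Lp ℝ (p e).conjExponent (G.edgeMeasure e)) :
    derPairing φ e F = ∫ x in Ioo 0 (G.length e), F x * Sobolev.der φ e x := by
  rw [derPairing, ContinuousLinearMap.lpPairing_eq_integral]
  exact integral_congr_ae (ae_of_all _ fun x => mul_comm _ _)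

theorem enorm_derPairing_le (φ : G.Sobolev p) (e : E)
    (F : Lp ℝ (p e).conjExponent (G.edgeMeasure e)) :
    ‖derPairing φ e F‖ₑ ≤ ‖((φ : G.PairSpace p) e).snd‖ₑ * ‖F‖ₑ := by
  rw [derPairing, ContinuousLinearMap.lpPairing_eq_integral, Lp.enorm_def, Lp.enorm_def]
  refine (enorm_integral_le_lintegral_enorm _).trans ?_
  simp only [ContinuousLinearMap.mul_apply', enorm_mul]
  exact lintegral_enorm_mul_enorm_le (Lp.aestronglyMeasurable _) (Lp.aestronglyMeasurable _)

theorem pLaplaceForm_eq_sum_derPairing (u φ : G.Sobolev p) :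
    G.pLaplaceForm p u φ = ∑ e, derPairing φ e (flux hp hp_top u e) := by
  refine Finset.sum_congr rfl fun e _ => ?_
  rw [derPairing_apply]
  refine integral_congr_ae ?_
  filter_upwards [coeFn_flux hp hp_top u e] with x hx
  rw [hx, signedPow]

include hp hp_top in
theorem integrable_signedPow_mul_der (u φ : G.Sobolev p) (e : E) :
    Integrable (fun x => signedPow (p e).toReal (Sobolev.der u e x) * Sobolev.der φ e x)
      (G.edgeMeasure e) :=
  (memLp_signedPow (q := (p e).conjExponent) (hp_top e).ne (conjExponent_ne_top (hp e))
    (Sobolev.memLp_der u e)).integrable_mul (Sobolev.memLp_der φ e)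

include hp hp_top in
theorem pLaplaceForm_comp_sub_mono {S : ℝ → ℝ} {K : NNReal} (hS : ContDiff ℝ 1 S)
    (hK : LipschitzWith K S) (hS_mono : Monotone S) (w u : G.Sobolev p) :
    G.pLaplaceForm p w (Sobolev.comp hS hK (u - w))
      ≤ G.pLaplaceForm p u (Sobolev.comp hS hK (u - w)) := by
  refine Finset.sum_le_sum fun e _ => integral_mono_ae
    (integrable_signedPow_mul_der hp hp_top w _ e) (integrable_signedPow_mul_der hp hp_top u _ e) ?_
  filter_upwards [Sobolev.der_comp hS hK (u - w) e, Sobolev.der_sub u w e] with x hx hx_sub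
  have hpow := monotone_signedPow (one_lt_toReal_of_holderConjugate (q := (p e).conjExponent)
    (hp_top e).ne (conjExponent_ne_top (hp e)))
  have hmul : 0 ≤ (signedPow (p e).toReal (Sobolev.der u e x)
      - signedPow (p e).toReal (Sobolev.der w e x)) * (Sobolev.der u e x - Sobolev.der w e x) := by
    rcases le_total (Sobolev.der u e x) (Sobolev.der w e x) with h | h
    · exact mul_nonneg_of_nonpos_of_nonpos (sub_nonpos.2 (hpow h)) (sub_nonpos.2 h)
    · exact mul_nonneg (sub_nonneg.2 (hpow h)) (sub_nonneg.2 h)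
  change signedPow _ _ * _ ≤ signedPow _ _ * _
  rw [hx, hx_sub]
  linear_combination mul_nonneg hS_mono.deriv_nonneg hmul

theorem pLaplaceForm_smul (u : G.Sobolev p) (c : ℝ) (φ : G.Sobolev p) :
    G.pLaplaceForm p u (c • φ) = c * G.pLaplaceForm p u φ := by
  simp only [pLaplaceForm, Finset.mul_sum, ← integral_const_mul]
  refine Finset.sum_congr rfl fun e _ => integral_congr_ae ?_
  filter_upwards [Sobolev.der_smul c φ e] with x hx
  rw [hx]
  ring

end Flux

end CompactMetricGraph

/-! ### The evolution equation tested in space -/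

namespace CompactMetricGraph

variable {V E : Type*} [Fintype V] [Fintype E] {G : CompactMetricGraph V E}
  {p : E → ℝ≥0∞} [∀ e, Fact (1 ≤ p e)]

/-- The states `W = (γ(u), 0)` that occur in the evolution problem. A strictly increasing `γₑ` with
`γₑ(ℝ) = ℝ` is encoded as an order isomorphism `Γ e`, so that its inverse is at hand. -/
def IsSuperposition (Γ : E → ℝ ≃o ℝ) (u : G.Sobolev p) (W : G.StateSpace) : Prop :=
  W.snd = 0 ∧ ∀ e, W.fst e =ᵐ[G.edgeMeasure e] fun x => Γ e (Sobolev.fn u e x)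

/-- The weak form `∫_G f φ dx + ∑ₐ ωₐ φ(a) - ∑ₑ ∫₀^{ℓₑ} |[u]ₑ'|^{pₑ-2} [u]ₑ' [φ]ₑ' dx`, for
`F = (f, ω)`, of the time derivative of the state. -/
noncomputable def source (F : G.StateSpace) (u φ : G.Sobolev p) : ℝ :=
  load φ F - G.pLaplaceForm p u φ

theorem exists_isSuperposition_of_mem_graphOperator {Γ : E → ℝ ≃o ℝ} {x y : G.StateSpace}
    (h : (x, y) ∈ G.graphOperator p fun e => Γ e) :
    ∃ w : G.Sobolev p, IsSuperposition Γ w x ∧ ∀ φ, G.pLaplaceForm p w φ = load φ y := by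
  obtain ⟨hx, w, hw, hweak⟩ := h
  refine ⟨w, ⟨hx, hw⟩, fun φ => ?_⟩
  have hφ := hweak φ
  rw [← pairingCLM_apply, ← pairingCLM_apply, map_add, pairingCLM_apply φ y.fst] at hφ
  rw [load_apply]
  linarith

theorem integrableOn_pLaplaceForm (hp : ∀ e, 1 < p e) (hp_top : ∀ e, p e < ∞) {T : ℝ}
    {u : ℝ → G.Sobolev p} (hu : G.MemLpTime T u) (φ : G.Sobolev p) :
    IntegrableOn (fun t => G.pLaplaceForm p (u t) φ) (Ioo 0 T) := by
  simp only [pLaplaceForm_eq_sum_derPairing hp hp_top]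
  exact integrable_finsetSum _ fun e _ =>
    (derPairing φ e).integrable_comp ((memLp_flux hp hp_top hu e).integrable Fact.out)

theorem integrableOn_source (hp : ∀ e, 1 < p e) (hp_top : ∀ e, p e < ∞) {T : ℝ}
    {F : ℝ → G.StateSpace} (hF : IntegrableOn F (Ioo 0 T)) {u : ℝ → G.Sobolev p}
    (hu : G.MemLpTime T u) (φ : G.Sobolev p) :
    IntegrableOn (fun t => source (F t) (u t) φ) (Ioo 0 T) :=
  ((load φ).integrable_comp hF).sub (integrableOn_pLaplaceForm hp hp_top hu φ)

theorem isEvolutionTest_smul {T : ℝ} (hT : 0 < T) {θ : ℝ → ℝ} (hθ : IsScalarTest 0 T θ)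
    (φ : G.Sobolev p) :
    G.IsEvolutionTest T (fun t => θ t • Sobolev.toOne φ) (fun t => deriv θ t • Sobolev.toOne φ)
      fun t => θ t • φ where
  continuousOn := (hθ.smooth.continuous.smul continuous_const).continuousOn
  integrable_deriv := (hθ.continuous_deriv.integrable_of_hasCompactSupport
    hθ.compact.deriv).integrableOn.smul_const _
  hasWeakDeriv := (hθ.hasWeakDeriv hT.le).smul_const (Sobolev.toOne φ : G.PairSpace fun _ => 1)
  memLp := by
    refine ⟨hθ.integrableOn.smul_const φ, fun e => ?_⟩
    have hcont : Continuous fun t => θ t • (φ : G.PairSpace p) e :=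
      hθ.smooth.continuous.smul continuous_const
    exact (hcont.memLp_of_hasCompactSupport hθ.compact.smul_right).restrict _
  same := ae_of_all _ fun t e => by
    filter_upwards [Sobolev.fn_toOne φ e, Sobolev.fn_smul (θ t) φ e,
      Sobolev.fn_smul (θ t) (Sobolev.toOne φ) e] with x h h_left h_right
    rw [h_left, h_right, h]
  zero_left := by simp only [hθ.eq_zero (x := 0) (by simp), zero_smul]
  zero_right := by simp only [hθ.eq_zero (x := T) (by simp), zero_smul]

theorem integral_mul_load {T : ℝ} {θ : ℝ → ℝ} (hθ : IsScalarTest 0 T θ) {F : ℝ → G.StateSpace}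
    (hF : IntegrableOn F (Ioo 0 T)) (φ : G.Sobolev p) :
    ∫ t in Ioo 0 T, θ t * load φ (F t) = (∫ t in Ioo 0 T, θ t * G.pairing (F t).fst φ)
      + ∑ a, ∫ t in Ioo 0 T, (F t).snd a * (θ t * Sobolev.vertexValue φ a) := by
  have hfst : IntegrableOn (fun t => G.pairing (F t).fst φ) (Ioo 0 T) := by
    simp only [← pairingCLM_apply]
    exact ((pairingCLM φ).comp (WithLp.fstL 1 ℝ G.L1 G.VertexL1)).integrable_comp hF
  have hsnd (a : V) :
      IntegrableOn (fun t => (F t).snd a * (θ t * Sobolev.vertexValue φ a)) (Ioo 0 T) := by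
    refine ((hθ.integrable_mul (((PiLp.proj 1 (fun _ : V => ℝ) a).comp
      (WithLp.sndL 1 ℝ G.L1 G.VertexL1)).integrable_comp hF)).1.mul_const
        (Sobolev.vertexValue φ a)).congr (ae_of_all _ fun t => ?_)
    change θ t * (F t).snd a * _ = _
    ring
  rw [← integral_finsetSum _ fun a _ => hsnd a,
    ← integral_add (hθ.integrable_mul hfst).1 (integrable_finsetSum _ fun a _ => hsnd a)]
  refine integral_congr_ae (ae_of_all _ fun t => ?_)
  simp only [load_apply, mul_add, Finset.mul_sum]
  congr 1
  exact Finset.sum_congr rfl fun a _ => by ring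

/-- The evolution equation `W' = source F u` on `]0, T[`, tested with functions of the space
variable only. -/
structure IsEvolutionSolutionOn (Γ : E → ℝ ≃o ℝ) (F : ℝ → G.StateSpace) (T : ℝ)
    (u : ℝ → G.Sobolev p) (W : ℝ → G.StateSpace) : Prop where
  integrableOn : IntegrableOn F (Ioo 0 T)
  memLpTime : G.MemLpTime T u
  continuousOn : ContinuousOn W (Icc 0 T)
  isSuperposition : ∀ᵐ t ∂(volume.restrict (Ioo 0 T)), IsSuperposition Γ (u t) (W t)
  hasWeakDeriv : ∀ φ : G.Sobolev p,
    HasWeakDeriv 0 T (fun t => load φ (W t)) fun t => source (F t) (u t) φ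

theorem IsEvolutionSolutionOn.load_sub_eq_integral (hp : ∀ e, 1 < p e) (hp_top : ∀ e, p e < ∞)
    {Γ : E → ℝ ≃o ℝ} {F : ℝ → G.StateSpace} {T : ℝ} {u : ℝ → G.Sobolev p} {W : ℝ → G.StateSpace}
    (h : IsEvolutionSolutionOn Γ F T u W) (hT : 0 < T) (φ : G.Sobolev p) {s t : ℝ}
    (hs : s ∈ Icc 0 T) (ht : t ∈ Icc 0 T) :
    load φ (W t - W s) = ∫ τ in s..t, source (F τ) (u τ) φ := by
  rw [map_sub]
  exact (h.hasWeakDeriv φ).sub_eq_integral hT ((load φ).continuous.comp_continuousOn h.continuousOn)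
    (integrableOn_source hp hp_top h.integrableOn h.memLpTime φ) hs ht

theorem integrableOn_toLp_prod {f : ℝ → G.L1} {ω : ℝ → G.VertexL1} {s : Set ℝ}
    (hf : IntegrableOn f s) (hω : IntegrableOn ω s) :
    IntegrableOn (fun t => (WithLp.toLp 1 (f t, ω t) : G.StateSpace)) s :=
  ContinuousLinearMap.integrable_comp
    (WithLp.prodContinuousLinearEquiv 1 ℝ G.L1 G.VertexL1).symm.toContinuousLinearMap
    (hf.prodMk hω)

theorem IsEvolutionWeakSolution.continuousOn_toLp {γ : E → ℝ → ℝ} {f : ℝ → G.L1}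
    {ω : ℝ → G.VertexL1} {v₀ : G.L1} {v : ℝ → G.L1} (h : G.IsEvolutionWeakSolution p γ f ω v₀ v)
    {T : ℝ} (hT : 0 < T) :
    ContinuousOn (fun t => (WithLp.toLp 1 (v t, 0) : G.StateSpace)) (Icc 0 T) :=
  (WithLp.prodContinuousLinearEquiv 1 ℝ G.L1 G.VertexL1).symm.continuous.comp_continuousOn
    ((h.continuousOn T hT).prodMk continuousOn_const)

theorem IsEvolutionWeakSolution.exists_isEvolutionSolutionOn (hp : ∀ e, 1 < p e)
    (hp_top : ∀ e, p e < ∞) (hG : G.NoIsolatedVertex) {Γ : E → ℝ ≃o ℝ} {f : ℝ → G.L1}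
    {ω : ℝ → G.VertexL1} {v₀ : G.L1} {v : ℝ → G.L1}
    (h : G.IsEvolutionWeakSolution p (fun e => Γ e) f ω v₀ v) {T : ℝ} (hT : 0 < T)
    (hf : IntegrableOn f (Ioo 0 T)) (hω : IntegrableOn ω (Ioo 0 T)) :
    ∃ u : ℝ → G.Sobolev p, IsEvolutionSolutionOn Γ (fun t => WithLp.toLp 1 (f t, ω t)) T u
      fun t => WithLp.toLp 1 (v t, 0) := by
  obtain ⟨u, hu, hvu, hweak⟩ := h.equation T hT
  have hF := integrableOn_toLp_prod hf hω
  refine ⟨u, hF, hu, h.continuousOn_toLp hT, ?_, fun φ θ hθ => ?_⟩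
  · filter_upwards [hvu] with t ht using ⟨rfl, ht⟩
  have htest := hweak _ _ _ (isEvolutionTest_smul hT hθ φ)
  simp only [pairing_smul_right, pLaplaceForm_smul, Sobolev.vertexValue_smul hG,
    Sobolev.vertexValue_toOne hG, pairing_congr _ (Sobolev.fn_toOne φ)] at htest
  have hsplit : ∫ t in Ioo 0 T, θ t • source (WithLp.toLp 1 (f t, ω t)) (u t) φ
      = (∫ t in Ioo 0 T, θ t * load φ (WithLp.toLp 1 (f t, ω t)))
        - ∫ t in Ioo 0 T, θ t * G.pLaplaceForm p (u t) φ := by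
    simp only [smul_eq_mul, source, mul_sub]
    exact integral_sub (hθ.integrable_mul ((load φ).integrable_comp hF)).1
      (hθ.integrable_mul (integrableOn_pLaplaceForm hp hp_top hu φ)).1
  rw [hsplit, integral_mul_load hθ hF]
  simp only [load_apply, WithLp.toLp_fst, WithLp.toLp_snd, smul_eq_mul, PiLp.zero_apply, zero_mul,
    Finset.sum_const_zero, add_zero]
  linarith

end CompactMetricGraph

/-! ### Difference quotients and the bracket -/

section DifferenceQuotient

variable {X : Type*} [NormedAddCommGroup X] [NormedSpace ℝ X]

theorem abs_differenceQuotient_le {J : X → ℝ} (hJ : LipschitzWith 1 J) {r : ℝ} (hr : 0 < r)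
    (x y : X) : |(J (x + r • y) - J x) / r| ≤ ‖y‖ := by
  rw [abs_div, abs_of_pos hr, div_le_iff₀ hr, ← Real.dist_eq]
  refine (hJ.dist_le_mul _ _).trans_eq ?_
  rw [NNReal.coe_one, one_mul, dist_eq_norm, add_sub_cancel_left, norm_smul,
    Real.norm_of_nonneg hr.le, mul_comm]

section Integrable

variable {α : Type*} [MeasurableSpace α] {μ : Measure α} {x y : α → X}

theorem integrable_differenceQuotient {J : X → ℝ} (hJ : LipschitzWith 1 J) {r : ℝ} (hr : 0 < r)
    (hx : AEStronglyMeasurable x μ) (hy : Integrable y μ) :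
    Integrable (fun t => (J (x t + r • y t) - J (x t)) / r) μ := by
  refine hy.norm.mono' ?_ (ae_of_all _ fun t => abs_differenceQuotient_le hJ hr _ _)
  simp only [div_eq_mul_inv]
  exact ((hJ.continuous.comp_aestronglyMeasurable (hx.add (hy.1.const_smul r))).sub
    (hJ.continuous.comp_aestronglyMeasurable hx)).mul_const _

theorem integrable_normBracket (hx : AEStronglyMeasurable x μ) (hy : Integrable y μ) :
    Integrable (fun t => normBracket (x t) (y t)) μ := by
  refine hy.norm.mono' (aestronglyMeasurable_of_tendsto_ae (𝓝[>] (0 : ℝ))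
    (f := fun r t => (‖x t + r • y t‖ - ‖x t‖) / r) (fun r => ?_)
    (ae_of_all _ fun t => tendsto_normBracket _ _)) (ae_of_all _ fun t => ?_)
  · simp only [div_eq_mul_inv]
    exact ((hx.add (hy.1.const_smul r)).norm.sub hx.norm).mul_const _
  · refine le_of_tendsto (tendsto_normBracket (x t) (y t)).abs ?_
    filter_upwards [self_mem_nhdsWithin] with r hr
      using abs_differenceQuotient_le lipschitzWith_one_norm hr _ _

end Integrable

theorem normBracket_zero_nonneg (y : X) : 0 ≤ normBracket 0 y :=
  ge_of_tendsto (tendsto_normBracket 0 y) (by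
    filter_upwards [self_mem_nhdsWithin] with r (hr : 0 < r)
    rw [norm_zero, sub_zero]
    positivity)

theorem DistribDerivLE.norm_of_approx {T : ℝ} {W Y : ℝ → X} {x : X} (hW : ContinuousOn W (Icc 0 T))
    (hY : IntegrableOn Y (Ioo 0 T)) {J : ℕ → X → ℝ} (hJ : ∀ n, LipschitzWith 1 (J n))
    (hJ_self : ∀ n, J n x = 0)
    (hJ_lim : ∀ (r : ℝ) t, Tendsto (fun n => J n (W t + r • Y t)) atTop (𝓝 ‖W t + r • Y t - x‖))
    (h : ∀ n r, 0 < r → DistribDerivLE T (fun t => J n (W t))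
      fun t => (J n (W t + r • Y t) - J n (W t)) / r) :
    DistribDerivLE T (fun t => ‖W t - x‖) fun t => normBracket (W t - x) (Y t) := by
  have := secondCountableTopologyEither_of_left ℝ X
  have hsub : ContinuousOn (fun t => W t - x) (Icc 0 T) := hW.sub continuousOn_const
  have hWm : AEStronglyMeasurable W (volume.restrict (Ioo 0 T)) :=
    (hW.mono Ioo_subset_Icc_self).aestronglyMeasurable measurableSet_Ioo
  have hint {g : ℝ → ℝ} (hg : ContinuousOn g (Icc 0 T)) : IntegrableOn g (Ioo 0 T) :=
    hg.integrableOn_Icc.mono_set Ioo_subset_Icc_self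
  have hJ_lim₀ : ∀ t, Tendsto (fun n => J n (W t)) atTop (𝓝 ‖W t - x‖) := fun t => by
    simpa only [zero_smul, add_zero] using hJ_lim 0 t
  have hquotient : ∀ r : ℝ, 0 < r → DistribDerivLE T (fun t => ‖W t - x‖)
      fun t => (‖W t - x + r • Y t‖ - ‖W t - x‖) / r := fun r hr =>
    .of_tendsto (l := atTop) (Eventually.of_forall fun n => h n r hr)
      (Eventually.of_forall fun n => hint ((hJ n).continuous.comp_continuousOn hW))
      (Eventually.of_forall fun n => integrable_differenceQuotient (hJ n) hr hWm hY)
      (Eventually.of_forall fun n t => by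
        simpa only [NNReal.coe_one, one_mul, hJ_self, sub_zero, dist_eq_norm, Real.norm_eq_abs]
          using (hJ n).dist_le_mul (W t) x)
      (Eventually.of_forall fun n t => abs_differenceQuotient_le (hJ n) hr _ _)
      (hint hsub.norm) hY.norm hJ_lim₀ fun t => by
        simpa only [sub_add_eq_add_sub] using ((hJ_lim r t).sub (hJ_lim₀ t)).div_const r
  have hpos : ∀ᶠ r : ℝ in 𝓝[>] 0, 0 < r := self_mem_nhdsWithin
  exact .of_tendsto (hpos.mono hquotient) (Eventually.of_forall fun _ => hint hsub.norm)
    (hpos.mono fun r hr => integrable_differenceQuotient lipschitzWith_one_norm hr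
      (hWm.sub aestronglyMeasurable_const) hY)
    (Eventually.of_forall fun _ t => (abs_norm _).le)
    (hpos.mono fun r hr t => abs_differenceQuotient_le lipschitzWith_one_norm hr _ _)
    (hint hsub.norm) hY.norm (fun _ => tendsto_const_nhds) fun t => tendsto_normBracket _ _

theorem IsIntegralSolution.of_distribDerivLE {A : Set (X × X)} {T : ℝ} {F W : ℝ → X}
    (hW : ContinuousOn W (Icc 0 T)) (hF : IntegrableOn F (Ioo 0 T))
    (h : ∀ x y, (x, y) ∈ A →
      DistribDerivLE T (fun t => ‖W t - x‖) fun t => normBracket (W t - x) (F t - y)) :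
    IsIntegralSolution A F (W 0) T W where
  continuousOn := hW
  initial := rfl
  locallyIntegrable x y _ := by
    have := secondCountableTopologyEither_of_left ℝ X
    have hint : IntegrableOn (fun t => normBracket (W t - x) (F t - y)) (Ioo 0 T) :=
      integrable_normBracket (((hW.sub continuousOn_const).mono
        Ioo_subset_Icc_self).aestronglyMeasurable measurableSet_Ioo) (hF.sub (integrable_const y))
    exact hint.locallyIntegrableOn
  inequality := h

end DifferenceQuotient

section BackwardOscillation

variable {F : Type*} [NormedAddCommGroup F]

theorem isMeanNegligible_backwardOsc {T : ℝ} {f : ℝ → F} (hf : IntegrableOn f (Ioo 0 T)) :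
    IsMeanNegligible T (backwardOsc f) := by
  simpa only [enorm_one, one_mul] using isMeanNegligible_enorm_mul_backwardOsc (q := 1) (q' := ∞)
    ENNReal.one_ne_top (memLp_top_const (1 : ℝ)) (memLp_one_iff_integrable.2 hf)

theorem ofReal_intervalIntegral_sub_le_backwardOsc {g : ℝ → ℝ} {s h : ℝ} (hh : 0 < h)
    (hg : IntervalIntegrable g volume (s - h) s) :
    ENNReal.ofReal ((∫ τ in (s - h)..s, g τ) - h * g s)
      ≤ backwardOsc g s h := by
  have hconst : h * g s = ∫ _ in (s - h)..s, g s := by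
    rw [intervalIntegral.integral_const, smul_eq_mul, sub_sub_cancel]
  have htranslate : (∫ τ in (s - h)..s, g τ) - h * g s = ∫ σ in Ioo 0 h, (g (s - σ) - g s) := by
    rw [hconst, ← intervalIntegral.integral_sub hg intervalIntegrable_const,
      ← integral_Ioc_eq_integral_Ioo, ← intervalIntegral.integral_of_le hh.le,
      intervalIntegral.integral_comp_sub_left (fun τ => g τ - g s) s, sub_zero]
  rw [htranslate]
  exact (ENNReal.ofReal_le_ofReal (le_abs_self _)).trans
    ((Real.enorm_eq_ofReal_abs _).symm.trans_le (enorm_integral_le_lintegral_enorm _))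

theorem aestronglyMeasurable_comp_sub_left {T : ℝ} {f : ℝ → F}
    (hf : AEStronglyMeasurable f (volume.restrict (Ioo 0 T))) {s h : ℝ} (hs : s ∈ Ioo h T) :
    AEStronglyMeasurable (fun σ => f (s - σ)) (volume.restrict (Ioo 0 h)) := by
  have hpre : (fun σ => s - σ) ⁻¹' Ioo (s - h) s = Ioo 0 h := by
    rw [preimage_const_sub_Ioo, sub_self, sub_sub_cancel]
  have hmp := (Measure.measurePreserving_sub_left volume s).restrict_preimage
    (measurableSet_Ioo (a := s - h) (b := s))
  rw [hpre] at hmp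
  refine (hf.mono_measure (Measure.restrict_mono ?_ le_rfl)).comp_measurePreserving hmp
  exact Ioo_subset_Ioo (sub_nonneg.2 hs.1.le) hs.2.le

end BackwardOscillation

/-! ### Convex approximations of the distance to a state -/

namespace CompactMetricGraph

variable {V E : Type*} [Fintype V] [Fintype E] {G : CompactMetricGraph V E}
  {p : E → ℝ≥0∞} [∀ e, Fact (1 ≤ p e)] {Γ : E → ℝ ≃o ℝ} {S : ℝ → ℝ} {K : NNReal}

theorem IsSuperposition.integrable_comp_fn {u : G.Sobolev p} {W : G.StateSpace}
    (hW : IsSuperposition Γ u W) (e : E) :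
    Integrable (fun x => Γ e (Sobolev.fn u e x)) (G.edgeMeasure e) :=
  (L1.integrable_coeFn (W.fst e)).congr (hW.2 e)

theorem norm_fst_sub_eq_sum_integral (U W : G.StateSpace) :
    ‖U.fst - W.fst‖ = ∑ e, ∫ x in Ioo 0 (G.length e), |U.fst e x - W.fst e x| := by
  rw [PiLp.norm_eq_of_L1]
  refine Finset.sum_congr rfl fun e _ => ?_
  rw [L1.norm_eq_integral_norm]
  refine integral_congr_ae ?_
  filter_upwards [Lp.coeFn_sub (U.fst e) (W.fst e)] with x hx
  exact congrArg norm hx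

theorem norm_sub_eq_of_snd_eq_zero {U W : G.StateSpace} (hW : W.snd = 0) :
    ‖U - W‖ = ‖U.fst - W.fst‖ + ‖U.snd‖ := by
  rw [WithLp.prod_norm_eq_of_L1, WithLp.sub_fst, WithLp.sub_snd, hW, sub_zero]

/-- A convex approximation of the distance of `U` from the state `(γ(w), 0)`, whose subgradient at
a state `(γ(u), 0)` is the function `S(u - w)`. -/
noncomputable def approxDist (S : ℝ → ℝ) (Γ : E → ℝ ≃o ℝ) (w : G.Sobolev p) (U : G.StateSpace) :
    ℝ :=
  (∑ e, ∫ x in Ioo 0 (G.length e), entropy S (Γ e) (Sobolev.fn w e x) (U.fst e x)) + ‖U.snd‖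

/-- The test function `S(u - w)`, an approximation of the sign of `u - w`. -/
noncomputable def signTest (hS : IsSmoothedSign S K) (u w : G.Sobolev p) : G.Sobolev p :=
  Sobolev.comp hS.contDiff hS.lipschitz (u - w)

section SignTest

variable (hS : IsSmoothedSign S K)

theorem fn_signTest (u w : G.Sobolev p) (e : E) : Sobolev.fn (signTest hS u w) e
    =ᵐ[G.edgeMeasure e] fun x => S (Sobolev.fn u e x - Sobolev.fn w e x) := by
  filter_upwards [Sobolev.fn_comp hS.contDiff hS.lipschitz (u - w) e, Sobolev.fn_sub u w e]
    with x hx hx_sub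
  rw [signTest, hx, hx_sub]

theorem abs_vertexValue_signTest_le (hG : G.NoIsolatedVertex) (u w : G.Sobolev p) (a : V) :
    |Sobolev.vertexValue (signTest hS u w) a| ≤ 1 := by
  rw [signTest, Sobolev.vertexValue_comp _ _ _ hG]
  exact hS.abs_le_one _

theorem abs_load_signTest_le (hG : G.NoIsolatedVertex) (u w : G.Sobolev p) (y : G.StateSpace) :
    |load (signTest hS u w) y| ≤ ‖y‖ := by
  refine abs_load_le (fun e => ?_) (abs_vertexValue_signTest_le hS hG u w) y
  filter_upwards [fn_signTest hS u w e] with x hx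
  rw [hx]
  exact hS.abs_le_one _

theorem enorm_snd_signTest_le (u w : G.Sobolev p) (e : E) :
    ‖((signTest hS u w : G.PairSpace p) e).snd‖ₑ
      ≤ ‖(K : ℝ) • ((u - w : G.PairSpace p) e).snd‖ₑ := by
  rw [enorm_le_iff_norm_le, norm_smul, NNReal.norm_eq]
  refine Lp.norm_le_mul_norm_of_ae_le_mul ?_
  filter_upwards [Sobolev.der_comp hS.contDiff hS.lipschitz (u - w) e] with x hx
  refine (congrArg norm hx).trans_le ?_
  rw [norm_mul]
  exact mul_le_mul_of_nonneg_right (hS.norm_deriv_le _) (norm_nonneg _)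

end SignTest

section ApproxDist

variable {w : G.Sobolev p} {x : G.StateSpace} (hx : IsSuperposition Γ w x)
include hx

theorem approxDist_self (S : ℝ → ℝ) : approxDist S Γ w x = 0 := by
  rw [approxDist, hx.1, norm_zero, add_zero]
  refine Finset.sum_eq_zero fun e _ => integral_eq_zero_of_ae ?_
  filter_upwards [hx.2 e] with t ht
  rw [ht]
  exact entropy_self S (Γ e) _

theorem lipschitzWith_approxDist (hS : IsSmoothedSign S K) :
    LipschitzWith 1 (approxDist S Γ w : G.StateSpace → ℝ) := by
  refine .of_dist_le_mul fun U W => ?_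
  rw [NNReal.coe_one, one_mul, Real.dist_eq, dist_eq_norm, WithLp.prod_norm_eq_of_L1, approxDist,
    approxDist, add_sub_add_comm, WithLp.sub_fst, WithLp.sub_snd, norm_fst_sub_eq_sum_integral,
    ← Finset.sum_sub_distrib]
  refine (abs_add_le _ _).trans (add_le_add ?_ (abs_norm_sub_norm_le _ _))
  refine (Finset.abs_sum_le_sum_abs _ _).trans (Finset.sum_le_sum fun e _ => ?_)
  exact hS.abs_integral_entropy_sub_le (Γ e) (Sobolev.aestronglyMeasurable_fn w e)
    (hx.integrable_comp_fn e) (L1.integrable_coeFn _) (L1.integrable_coeFn _)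

theorem tendsto_approxDist_smoothSign (U : G.StateSpace) :
    Tendsto (fun n => approxDist (smoothSign n) Γ w U) atTop (𝓝 ‖U - x‖) := by
  rw [norm_sub_eq_of_snd_eq_zero hx.1, norm_fst_sub_eq_sum_integral]
  refine (tendsto_finsetSum _ fun e _ => ?_).add_const _
  have hlim := tendsto_integral_entropy_smoothSign (Γ e) (Sobolev.aestronglyMeasurable_fn w e)
    (hx.integrable_comp_fn e) (L1.integrable_coeFn (U.fst e))
  convert hlim using 2
  refine integral_congr_ae ?_
  filter_upwards [hx.2 e] with t ht
  rw [ht]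

theorem load_signTest_sub_le (hS : IsSmoothedSign S K) (hG : G.NoIsolatedVertex) {u : G.Sobolev p}
    {W : G.StateSpace} (hW : IsSuperposition Γ u W) (U : G.StateSpace) :
    load (signTest hS u w) (U - W) ≤ approxDist S Γ w U - approxDist S Γ w W := by
  have hvertex := le_of_abs_le (abs_sum_mul_vertexValue_le
    (abs_vertexValue_signTest_le hS hG u w) U.snd)
  have hedge : G.pairing (U.fst - W.fst) (signTest hS u w)
      ≤ ∑ e, ((∫ t in Ioo 0 (G.length e), entropy S (Γ e) (Sobolev.fn w e t) (U.fst e t))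
        - ∫ t in Ioo 0 (G.length e), entropy S (Γ e) (Sobolev.fn w e t) (W.fst e t)) := by
    refine Finset.sum_le_sum fun e _ => le_of_eq_of_le (integral_congr_ae ?_)
      (hS.integral_mul_sub_le_integral_entropy_sub (Γ e) (Sobolev.aestronglyMeasurable_fn w e)
        (hx.integrable_comp_fn e) (L1.integrable_coeFn (W.fst e)) (L1.integrable_coeFn (U.fst e)))
    filter_upwards [Lp.coeFn_sub (U.fst e) (W.fst e), hW.2 e, fn_signTest hS u w e]
      with t h_sub h_state h_test
    rw [h_test, h_state, OrderIso.symm_apply_apply, mul_comm, ← h_state]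
    exact congrArg _ h_sub
  rw [Finset.sum_sub_distrib] at hedge
  rw [load_apply, WithLp.sub_fst, WithLp.sub_snd, approxDist, approxDist, hW.1, sub_zero, norm_zero]
  linarith

theorem source_signTest_le (hp : ∀ e, 1 < p e) (hp_top : ∀ e, p e < ∞) (hS : IsSmoothedSign S K)
    (hG : G.NoIsolatedVertex) {y : G.StateSpace} (hw : ∀ φ, G.pLaplaceForm p w φ = load φ y)
    {u : G.Sobolev p} {W : G.StateSpace} (hW : IsSuperposition Γ u W) (F : G.StateSpace) {r : ℝ}
    (hr : 0 < r) : source F u (signTest hS u w)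
      ≤ (approxDist S Γ w (W + r • (F - y)) - approxDist S Γ w W) / r := by
  have hmono := pLaplaceForm_comp_sub_mono hp hp_top hS.contDiff hS.lipschitz hS.monotone w u
  have hsub := load_signTest_sub_le hx hS hG hW (W + r • (F - y))
  rw [add_sub_cancel_left, map_smul, smul_eq_mul, map_sub, ← hw] at hsub
  rw [le_div_iff₀ hr, mul_comm]
  refine (mul_le_mul_of_nonneg_left ?_ hr.le).trans hsub
  exact sub_le_sub_left hmono _

end ApproxDist

end CompactMetricGraph

/-! ### The inequality of the integral solution -/

namespace CompactMetricGraph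

variable {V E : Type*} [Fintype V] [Fintype E] {G : CompactMetricGraph V E}
  {p : E → ℝ≥0∞} [∀ e, Fact (1 ≤ p e)] (hp : ∀ e, 1 < p e) (hp_top : ∀ e, p e < ∞)

theorem enorm_source_sub_le {φ : G.Sobolev p} (hφ : ∀ y : G.StateSpace, |load φ y| ≤ ‖y‖)
    (F F' : G.StateSpace) (u u' : G.Sobolev p) :
    ‖source F u φ - source F' u' φ‖ₑ ≤ ‖F - F'‖ₑ + ∑ e, ‖((φ : G.PairSpace p) e).snd‖ₑ
      * ‖flux hp hp_top u e - flux hp hp_top u' e‖ₑ := by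
  have hsource : source F u φ - source F' u' φ = load φ (F - F')
      - ∑ e, derPairing φ e (flux hp hp_top u e - flux hp hp_top u' e) := by
    simp only [source, pLaplaceForm_eq_sum_derPairing hp hp_top, map_sub, Finset.sum_sub_distrib]
    ring
  rw [hsource]
  refine enorm_sub_le.trans (add_le_add (enorm_le_iff_norm_le.2 (hφ _)) ?_)
  exact (enorm_sum_le _ _).trans (Finset.sum_le_sum fun e _ => enorm_derPairing_le φ e _)

/-- The error, integrated over the backward time interval of length `h` that ends at `s`, of
replacing the source by its value at time `s` in the equation tested with `S(u(s) - w)`, for a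
`K`-Lipschitz function `S`. -/
noncomputable def freezingError (K : NNReal) (F : ℝ → G.StateSpace) (u : ℝ → G.Sobolev p)
    (w : G.Sobolev p) : ℝ → ℝ → ℝ≥0∞ :=
  backwardOsc F + ∑ e, fun s h => ‖(K : ℝ) • ((u s - w : G.PairSpace p) e).snd‖ₑ
    * backwardOsc (fun t => flux hp hp_top (u t) e) s h

theorem isMeanNegligible_freezingError {T : ℝ} {F : ℝ → G.StateSpace}
    (hF : IntegrableOn F (Ioo 0 T)) {u : ℝ → G.Sobolev p} (hu : G.MemLpTime T u) (K : NNReal)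
    (w : G.Sobolev p) : IsMeanNegligible T (freezingError hp hp_top K F u w) :=
  (isMeanNegligible_backwardOsc hF).add <| .sum _ fun e =>
    isMeanNegligible_enorm_mul_backwardOsc (conjExponent_ne_top (hp e))
      (((hu.memLp_snd e).sub (memLp_const ((w : G.PairSpace p) e).snd)).const_smul (K : ℝ))
      (memLp_flux hp hp_top hu e)

theorem backwardOsc_source_signTest_le {T : ℝ} {F : ℝ → G.StateSpace}
    (hF : IntegrableOn F (Ioo 0 T)) {u : ℝ → G.Sobolev p} (hu : G.MemLpTime T u)
    (hG : G.NoIsolatedVertex) {S : ℝ → ℝ} {K : NNReal} (hS : IsSmoothedSign S K)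
    (w : G.Sobolev p) {s h : ℝ} (hs : s ∈ Ioo h T) :
    backwardOsc (fun t => source (F t) (u t) (signTest hS (u s) w)) s h
      ≤ freezingError hp hp_top K F u w s h := by
  have hF_meas : AEMeasurable (fun σ => ‖F (s - σ) - F s‖ₑ) (volume.restrict (Ioo 0 h)) :=
    ((aestronglyMeasurable_comp_sub_left hF.1 hs).sub aestronglyMeasurable_const).enorm
  have hflux_meas (e : E) : AEMeasurable (fun σ => ‖flux hp hp_top (u (s - σ)) e
      - flux hp hp_top (u s) e‖ₑ) (volume.restrict (Ioo 0 h)) :=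
    ((aestronglyMeasurable_comp_sub_left (memLp_flux hp hp_top hu e).1 hs).sub
      aestronglyMeasurable_const).enorm
  refine (lintegral_mono fun σ => enorm_source_sub_le hp hp_top
    (abs_load_signTest_le hS hG (u s) w) _ _ _ _).trans ?_
  rw [lintegral_add_left' hF_meas, lintegral_finsetSum' _ fun e _ => (hflux_meas e).const_mul _]
  simp only [freezingError, Pi.add_apply, Finset.sum_apply, backwardOsc,
    lintegral_const_mul' _ _ enorm_ne_top]
  gcongr
  exact enorm_snd_signTest_le hS _ _ _

variable {Γ : E → ℝ ≃o ℝ} {F : ℝ → G.StateSpace} {T : ℝ} {u : ℝ → G.Sobolev p}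
  {W : ℝ → G.StateSpace} {w : G.Sobolev p} {x y : G.StateSpace}

namespace IsEvolutionSolutionOn

include hp hp_top

/-- The test function in the equation over `[s - h, s]` is kept fixed at its value at time `s`,
where it is a subgradient, so that no chain rule in time is needed. -/
theorem approxDist_backward_difference_le (hsol : IsEvolutionSolutionOn Γ F T u W)
    (hG : G.NoIsolatedVertex) (hx : IsSuperposition Γ w x)
    (hw : ∀ φ, G.pLaplaceForm p w φ = load φ y) {S : ℝ → ℝ} {K : NNReal} (hS : IsSmoothedSign S K)
    {r : ℝ} (hr : 0 < r) {s h : ℝ} (hh : 0 < h) (hs : s ∈ Ioo h T)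
    (hWs : IsSuperposition Γ (u s) (W s)) :
    ENNReal.ofReal (approxDist S Γ w (W s) - approxDist S Γ w (W (s - h))
        - h * ((approxDist S Γ w (W s + r • (F s - y)) - approxDist S Γ w (W s)) / r))
      ≤ freezingError hp hp_top K F u w s h := by
  set φ := signTest hS (u s) w
  have hT : 0 < T := hh.trans (hs.1.trans hs.2)
  have hs_mem : s ∈ Icc 0 T := ⟨(hh.trans hs.1).le, hs.2.le⟩
  have hsh_mem : s - h ∈ Icc 0 T := ⟨sub_nonneg.2 hs.1.le, by linarith [hs.2]⟩
  have hsub : load φ (W (s - h) - W s) ≤ approxDist S Γ w (W (s - h)) - approxDist S Γ w (W s) :=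
    load_signTest_sub_le hx hS hG hWs _
  have hequation := hsol.load_sub_eq_integral hp hp_top hT φ hsh_mem hs_mem
  rw [← neg_sub, map_neg, hequation] at hsub
  have hrate := mul_le_mul_of_nonneg_left
    (source_signTest_le hx hp hp_top hS hG hw hWs (F s) hr) hh.le
  have hint : IntervalIntegrable (fun τ => source (F τ) (u τ) φ) volume (s - h) s :=
    intervalIntegrable_of_integrableOn_Ioo (by linarith)
      ((integrableOn_source hp hp_top hsol.integrableOn hsol.memLpTime φ).mono_set
        (Ioo_subset_Ioo hsh_mem.1 hs_mem.2))
  calc _ ≤ ENNReal.ofReal ((∫ τ in (s - h)..s, source (F τ) (u τ) φ)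
        - h * source (F s) (u s) φ) := ENNReal.ofReal_le_ofReal (by linarith)
    _ ≤ backwardOsc (fun t => source (F t) (u t) φ) s h :=
        ofReal_intervalIntegral_sub_le_backwardOsc hh hint
    _ ≤ _ := backwardOsc_source_signTest_le hp hp_top hsol.integrableOn hsol.memLpTime hG hS w hs

theorem distribDerivLE_approxDist (hsol : IsEvolutionSolutionOn Γ F T u W) (hT : 0 < T)
    (hG : G.NoIsolatedVertex) (hx : IsSuperposition Γ w x)
    (hw : ∀ φ, G.pLaplaceForm p w φ = load φ y) {S : ℝ → ℝ} {K : NNReal} (hS : IsSmoothedSign S K)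
    {r : ℝ} (hr : 0 < r) :
    DistribDerivLE T (fun t => approxDist S Γ w (W t)) fun t =>
      (approxDist S Γ w (W t + r • (F t - y)) - approxDist S Γ w (W t)) / r := by
  have := secondCountableTopologyEither_of_left ℝ G.StateSpace
  have hJ := lipschitzWith_approxDist hx hS
  have hW_meas : AEStronglyMeasurable W (volume.restrict (Ioo 0 T)) :=
    (hsol.continuousOn.mono Ioo_subset_Icc_self).aestronglyMeasurable measurableSet_Ioo
  refine .of_backward_difference_le hT (hJ.continuous.comp_continuousOn hsol.continuousOn)
    (integrable_differenceQuotient hJ hr hW_meas (hsol.integrableOn.sub (integrable_const y)))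
    (isMeanNegligible_freezingError hp hp_top hsol.integrableOn hsol.memLpTime K w) fun h hh => ?_
  filter_upwards [ae_restrict_of_ae_restrict_of_subset (Ioo_subset_Ioo_left hh.le)
    hsol.isSuperposition, ae_restrict_mem measurableSet_Ioo] with s hWs hs
  exact hsol.approxDist_backward_difference_le hp hp_top hG hx hw hS hr hh hs hWs

theorem distribDerivLE_norm_sub (hsol : IsEvolutionSolutionOn Γ F T u W) (hT : 0 < T)
    (hG : G.NoIsolatedVertex) (hx : IsSuperposition Γ w x)
    (hw : ∀ φ, G.pLaplaceForm p w φ = load φ y) :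
    DistribDerivLE T (fun t => ‖W t - x‖) fun t => normBracket (W t - x) (F t - y) :=
  .norm_of_approx hsol.continuousOn (hsol.integrableOn.sub (integrable_const y))
    (fun n => lipschitzWith_approxDist hx (isSmoothedSign_smoothSign n))
    (fun n => approxDist_self hx (smoothSign n))
    (fun _ _ => tendsto_approxDist_smoothSign hx _)
    fun n _ hr => hsol.distribDerivLE_approxDist hp hp_top hT hG hx hw
      (isSmoothedSign_smoothSign n) hr

end IsEvolutionSolutionOn

end CompactMetricGraph

theorem isIntegralSolution_of_isEmpty {V E : Type*} [Fintype V] [Fintype E] [IsEmpty E]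
    {G : CompactMetricGraph V E} {p : E → ℝ≥0∞} [∀ e, Fact (1 ≤ p e)] {γ : E → ℝ → ℝ} {v₀ : G.L1}
    {f : ℝ → G.L1} {ω : ℝ → G.VertexL1} {v : ℝ → G.L1}
    (hv : G.IsEvolutionWeakSolution p γ f ω v₀ v) {T : ℝ} (hT : 0 < T)
    (hf : IntegrableOn f (Ioo 0 T)) (hω : IntegrableOn ω (Ioo 0 T)) :
    IsIntegralSolution (G.graphOperator p γ)
      (fun t => (WithLp.toLp 1 (f t, ω t) : G.StateSpace)) (WithLp.toLp 1 (v₀, 0)) T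
      (fun t => WithLp.toLp 1 (v t, 0)) := by
  rw [← hv.initial]
  refine .of_distribDerivLE (hv.continuousOn_toLp hT)
    (CompactMetricGraph.integrableOn_toLp_prod hf hω) fun x y hxy ξ _ hξ_nonneg => ?_
  have hx : ∀ t, (WithLp.toLp 1 (v t, 0) : G.StateSpace) - x = 0 := fun t => sub_eq_zero.2 <|
    WithLp.ofLp_injective 1 (Prod.ext (Subsingleton.elim _ _) hxy.1.symm)
  simp only [hx, norm_zero, zero_mul, integral_zero, neg_zero]
  exact integral_nonneg fun t => mul_nonneg (normBracket_zero_nonneg _) (hξ_nonneg t)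

theorem mainTheorem6_general {V E : Type*} [Fintype V] [Fintype E] (G : CompactMetricGraph V E)
    (hG : G.NoIsolatedVertex)
    (p : E → ℝ≥0∞) [∀ e, Fact (1 ≤ p e)] (hp : ∀ e, 1 < p e) (hp_top : ∀ e, p e < ∞)
    (γ : E → ℝ → ℝ) (hγ_mono : ∀ e, StrictMono (γ e)) (hγ_surj : ∀ e, Function.Surjective (γ e))
    (v₀ : G.L1)
    (f : ℝ → G.L1) (hf : ∀ T : ℝ, 0 < T → IntegrableOn f (Ioo 0 T))
    (ω : ℝ → G.VertexL1) (hω : ∀ T : ℝ, 0 < T → IntegrableOn ω (Ioo 0 T))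
    (v : ℝ → G.L1) (hv : G.IsEvolutionWeakSolution p γ f ω v₀ v) :
    ∀ T : ℝ, 0 < T →
      IsIntegralSolution (G.graphOperator p γ)
        (fun t => (WithLp.toLp 1 (f t, ω t) : G.StateSpace))
        (WithLp.toLp 1 (v₀, 0)) T
        (fun t => WithLp.toLp 1 (v t, 0)) := by
  intro T hT
  let Γ : E → ℝ ≃o ℝ := fun e => (hγ_mono e).orderIsoOfSurjective (γ e) (hγ_surj e)
  obtain ⟨u, hsol⟩ := CompactMetricGraph.IsEvolutionWeakSolution.exists_isEvolutionSolutionOn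
    (Γ := Γ) hp hp_top hG hv hT (hf T hT) (hω T hT)
  rw [← hv.initial]
  refine .of_distribDerivLE hsol.continuousOn hsol.integrableOn fun x y hxy => ?_
  obtain ⟨w, hx, hw⟩ := CompactMetricGraph.exists_isSuperposition_of_mem_graphOperator (Γ := Γ) hxy
  exact hsol.distribDerivLE_norm_sub hp hp_top hT hG hx hw

theorem mainTheorem6 {V E : Type*} [Fintype V] [Fintype E] (G : CompactMetricGraph V E)
    (hG : G.Connected)
    (p : E → ℝ≥0∞) [∀ e, Fact (1 ≤ p e)] (hp : ∀ e, 1 < p e) (hp_top : ∀ e, p e < ∞)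
    (γ : E → ℝ → ℝ) (hγ_cont : ∀ e, Continuous (γ e)) (hγ_mono : ∀ e, StrictMono (γ e))
    (hγ_surj : ∀ e, Function.Surjective (γ e)) (hγ_zero : ∀ e, γ e 0 = 0)
    (v₀ : G.L1)
    (f : ℝ → G.L1) (hf : ∀ T : ℝ, 0 < T → IntegrableOn f (Ioo 0 T))
    (ω : ℝ → G.VertexL1) (hω : ∀ T : ℝ, 0 < T → IntegrableOn ω (Ioo 0 T))
    (v : ℝ → G.L1) (hv : G.IsEvolutionWeakSolution p γ f ω v₀ v) :
    ∀ T : ℝ, 0 < T →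
      IsIntegralSolution (G.graphOperator p γ)
        (fun t => (WithLp.toLp 1 (f t, ω t) : G.StateSpace))
        (WithLp.toLp 1 (v₀, 0)) T
        (fun t => WithLp.toLp 1 (v t, 0)) := by
  rcases isEmpty_or_nonempty E with _ | _
  · exact fun T hT => isIntegralSolution_of_isEmpty hv hT (hf T hT) (hω T hT)
  · exact mainTheorem6_general G hG.noIsolatedVertex p hp hp_top γ hγ_mono hγ_surj v₀ f hf ω hω v hv
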